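/- Let $m,k,R>0$ and $\zeta\in\{1,-1\}$. The Kepler problem has phase space $T^*(\mathbb R^3\setminus\{0\})=\{(\vec r,\vec p):\vec r\neq 0\}$, with symplectic form $d(\vec p\cdot d\vec r)$ and Hamiltonian $E(\vec r,\vec p)=\frac{p^2}{2m}-\frac{mk}{r}$, where $r=\|\vec r\|$, $p=\|\vec p\|$; let $X_E$ be the Hamiltonian vector field of $E$ (for a symplectic form $\omega$ the convention is $i(X_f)\omega=-df$), so that $X_E$ is given by $\dot{\vec r}=\vec p/m$, $\dot{\vec p}=-km\vec r/r^3$. Let $U_\zeta$ be the open subset of the phase space where $E<0$ if $\zeta=1$, $E>0$ if $\zeta=-1$. On $\mathbb R^4=\mathbb R^3\times\mathbb R\ni(\vec\mu,h)$ let $a\cdot b=\vec\mu_a\cdot\vec\mu_b+\zeta h_ah_b$. Let $Q=\{M=(\vec\mu,h):h^2+\zeta\|\vec\mu\|^2=R^2\}$, with the additional condition $h>0$ if $\zeta=-1$: $Q$ is a $3$-sphere if $\zeta=1$, and the upper sheet of a two-sheeted hyperboloid if $\zeta=-1$. Let $N=(0,R)$. By means of the scalar product, $T^*Q$ is identified with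 $\{(M,W):M\in Q,\ M\cdot W=0\}$, with symplectic form $d(W\cdot dM)$; put $\|W\|^2=W\cdot W$. Write $T^*_0$ for cotangent bundles minus their zero sections. For $\rho>0$ let $S_{\rho,R}^{-1}(\vec r,\vec p)=(M,W)$, with $M=(\vec\mu,h)$, $W=(\vec W_3,W_h)$, $$\vec\mu=\frac{2R\rho}{\rho^2+\zeta p^2}\vec p,\quad h=R\,\frac{p^2-\zeta\rho^2}{p^2+\zeta\rho^2},\quad \vec W_3=\frac{\rho^2+\zeta p^2}{2R\rho}\vec r-\frac{\zeta\,\vec r\cdot\vec p}{R\rho}\vec p,\quad W_h=\frac{\zeta\,\vec r\cdot\vec p}{R}.$$ (This is the cotangent lift, with $W\cdot dM=\vec r\cdot d\vec p$, of the inverse of the (generalized) stereographic projection from the north pole of the quadric $h^2+\zeta\|\vec\mu\|^2=\rho^2$, composed with the homothety of ratio $R/\rho$.) Let $S^{-1}$ be the map on $U_\zeta$ that coincides with $S_{\rho,R}^{-1}$ on each energy level $E=-\zeta\rho^2/(2m)$, $\rho>0$. Then: 1. $S^{-1}$ is a diffeomorphism of $U_\zeta$ onto $T^*_0(Q\setminus\{N\})$.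 It transforms $E$ into $$H=-\frac{\zeta k^2m^3}{2R^2\|W\|^2},$$ and it transforms $X_E$ into the conformally Hamiltonian vector field $g\,X_H$, $g=\frac{R}{h-R}$, where $X_H$ is the Hamiltonian vector field of $H$. 2. $H$ is smooth on the whole of $T^*_0Q$, and $X_H$ is complete on $T^*_0Q$. Its flow is, for $\zeta=1$, $$\Phi_{X_H}(s,(M,W))=\Bigl(\cos(\lambda s)M+\tfrac{R}{\|W\|}\sin(\lambda s)W,\ -\tfrac{\|W\|}{R}\sin(\lambda s)M+\cos(\lambda s)W\Bigr),$$ and for $\zeta=-1$ $$\Phi_{X_H}(s,(M,W))=\Bigl(\cosh(\lambda s)M-\tfrac{R}{\|W\|}\sinh(\lambda s)W,\ -\tfrac{\|W\|}{R}\sinh(\lambda s)M+\cosh(\lambda s)W\Bigr),$$ with $\lambda=\frac{k^2m^3}{R^3\|W\|^3}$. 3. Let $F(\vec r,\vec p)=\Phi_{X_H}\bigl(s,S^{-1}(\vec r,\vec p)\bigr)$ with $s=-\frac{\vec p\cdot\vec r}{2E(\vec r,\vec p)}$, and let $G$ be $F$ followed by $(M,W)\mapsto(M,-W)$. Then $F$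 and $G$ are diffeomorphisms of $U_\zeta$ onto open subsets of $T^*Q$; $F$ is anti-symplectic, $F^*d(W\cdot dM)=-d(\vec p\cdot d\vec r)$, and $G$ is symplectic, $G^*d(W\cdot dM)=d(\vec p\cdot d\vec r)$. Moreover $G$ transforms $X_E$ into $X_H$. 4. $G$ is the Gyorgyi–Ligon–Schaaf map $(\vec r,\vec p)\mapsto(\xi,\eta)$, up to the homothety of ratio $R$: $G=(R\,\xi,\tfrac1R\,\eta)$, where, with $\rho=\sqrt{-2m\zeta E}$, $K=m^2k$, $\varphi=\frac{\rho\,\vec r\cdot\vec p}{K}$, and $(\mathrm c,\mathrm s)=(\cos\varphi,\sin\varphi)$ if $\zeta=1$, $(\cosh\varphi,\sinh\varphi)$ if $\zeta=-1$, $$\xi_0=\zeta\frac{\rho}{K}\,\vec r\cdot\vec p\ \mathrm s+\Bigl(\frac{rp^2}{K}-1\Bigr)\mathrm c,\qquad \vec\xi=\zeta\Bigl(\frac{\vec r}{r}-\frac{\vec r\cdot\vec p}{K}\vec p\Bigr)\mathrm s+\zeta\frac{\rho}{K}\,r\,\vec p\ \mathrm c,$$ $$\eta_0=-\zeta\,\vec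 r\cdot\vec p\ \mathrm c+\zeta\frac{K}{\rho}\Bigl(\frac{rp^2}{K}-1\Bigr)\mathrm s,\qquad \vec\eta=-\zeta\frac{K}{\rho}\Bigl(\frac{\vec r}{r}-\frac{\vec r\cdot\vec p}{K}\vec p\Bigr)\mathrm c+r\,\vec p\ \mathrm s,$$ the component along the $h$-axis being written with the index $0$. -/

import Mathlib

open scoped ContDiff

noncomputable section

namespace Kepler

/-! ### Spaces

The physical space is `ℝ³` with its Euclidean structure; the phase space of the Kepler problem
consists of pairs `(r, p)`. The auxiliary four-dimensional space consists of pairs `(μ, h)`, and a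
point of the cotangent bundle of a quadric is a pair `(M, W)` of vectors of that space. -/

/-- Euclidean three-space. -/
abbrev E3 := EuclideanSpace ℝ (Fin 3)

/-- The four-dimensional space `ℝ³ × ℝ`, with elements `(μ, h)`. (Only its vector space structure
and its topology matter; the scalar product is `form ζ` below.) -/
abbrev F4 := E3 × ℝ

/-- Pairs `(r, p)`: position and momentum. -/
abbrev KPhase := E3 × E3

/-- Pairs `(M, W)` of vectors of the four-dimensional space. -/
abbrev QPhase := F4 × F4

/-! ### Smooth maps between subsets of normed spaces -/

/-- A map is smooth on a subset `s` of a normed space if, near each point of `s`, it is the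
restriction to `s` of a `C^∞` map defined on an open set. -/
def SmoothOn {V V' : Type*} [NormedAddCommGroup V] [NormedSpace ℝ V] [NormedAddCommGroup V']
    [NormedSpace ℝ V'] (f : V → V') (s : Set V) : Prop :=
  ∀ x ∈ s, ∃ U : Set V, IsOpen U ∧ x ∈ U ∧ ∃ g : V → V', ContDiffOn ℝ ∞ g U ∧ Set.EqOn f g (s ∩ U)

/-- `f` restricts to a diffeomorphism of `A` onto `B`: a smooth bijection with a smooth inverse. -/
def IsDiffeoOnto {V V' : Type*} [NormedAddCommGroup V] [NormedSpace ℝ V] [NormedAddCommGroup V']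
    [NormedSpace ℝ V'] (f : V → V') (A : Set V) (B : Set V') : Prop :=
  Set.BijOn f A B ∧ SmoothOn f A ∧ ∃ g : V' → V, SmoothOn g B ∧ Set.InvOn g f A B

/-- `f` restricts to a diffeomorphism of `A` onto a (relatively) open subset of `B`. -/
def IsDiffeoOntoOpen {V V' : Type*} [NormedAddCommGroup V] [NormedSpace ℝ V]
    [NormedAddCommGroup V'] [NormedSpace ℝ V'] (f : V → V') (A : Set V) (B : Set V') : Prop :=
  (∃ O : Set V', IsOpen O ∧ f '' A = O ∩ B) ∧ IsDiffeoOnto f A (f '' A)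

/-! ### Hamiltonian vectors and complete flows -/

/-- `X` is the value at a point of the Hamiltonian vector field of a function with differential
`dH` at that point, where `T` is the tangent space and `σ` the symplectic form at that point:
`X` is tangent and `i(X) σ = - dH` on `T`. -/
def IsHamVec {V : Type*} [NormedAddCommGroup V] [NormedSpace ℝ V]
    (T : Submodule ℝ V) (σ : V → V → ℝ) (dH : V →L[ℝ] ℝ) (X : V) : Prop :=
  X ∈ T ∧ ∀ v ∈ T, σ X v = - dH v

/-- The Hamiltonian vector determined by `T`, `σ` and `dH`. -/
def hamVec {V : Type*} [NormedAddCommGroup V] [NormedSpace ℝ V]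
    (T : Submodule ℝ V) (σ : V → V → ℝ) (dH : V →L[ℝ] ℝ) : V :=
  Classical.epsilon (IsHamVec T σ dH)

/-- `Φ` is the flow, on the manifold `S`, of the vector field `X`, and this flow is defined on the
whole of `ℝ × S`; in particular `X` is complete on `S`. -/
structure IsCompleteFlow {V : Type*} [NormedAddCommGroup V] [NormedSpace ℝ V]
    (S : Set V) (X : V → V) (Φ : ℝ → V → V) : Prop where
  zero : ∀ y ∈ S, Φ 0 y = y
  mem : ∀ y ∈ S, ∀ s : ℝ, Φ s y ∈ S
  hasDerivAt : ∀ y ∈ S, ∀ s : ℝ, HasDerivAt (fun u : ℝ => Φ u y) (X (Φ s y)) s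
  smooth : SmoothOn (fun z : ℝ × V => Φ z.1 z.2) (Set.univ ×ˢ S)
  unique : ∀ y ∈ S, ∀ (I : Set ℝ) (γ : ℝ → V), IsOpen I → I.OrdConnected → (0 : ℝ) ∈ I →
    γ 0 = y → (∀ s ∈ I, γ s ∈ S ∧ HasDerivAt γ (X (γ s)) s) → ∀ s ∈ I, γ s = Φ s y

/-! ### The Kepler problem -/

/-- The energy `E(r, p) = p² / (2 m) - m k / r`. -/
def energy (m k : ℝ) (x : KPhase) : ℝ := ‖x.2‖ ^ 2 / (2 * m) - m * k / ‖x.1‖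

/-- The part of the phase space `T*(ℝ³ ∖ {0})` of the Kepler problem on which the energy is
negative if `ζ = 1`, positive if `ζ = -1`. -/
def keplerPhase (ζ m k : ℝ) : Set KPhase := {x | x.1 ≠ 0 ∧ ζ * energy m k x < 0}

/-- The canonical symplectic form `d(p · dr)` of `T*ℝ³`. -/
def omegaK (u v : KPhase) : ℝ := inner ℝ u.2 v.1 - inner ℝ v.2 u.1

/-- The Kepler vector field: the Hamiltonian vector field of the energy. -/
def XE (m k : ℝ) (x : KPhase) : KPhase := hamVec ⊤ omegaK (fderiv ℝ (energy m k) x)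

/-! ### The quadric and its cotangent bundle -/

/-- The scalar product on the four-dimensional space: Euclidean if `ζ = 1`, Lorentzian if
`ζ = -1`. -/
def form (ζ : ℝ) (a b : F4) : ℝ := inner ℝ a.1 b.1 + ζ * (a.2 * b.2)

/-- The sphere of radius `R` if `ζ = 1`, the upper sheet of a two-sheeted hyperboloid if
`ζ = -1`. -/
def quadric (ζ R : ℝ) : Set F4 := {M | M.2 ^ 2 + ζ * ‖M.1‖ ^ 2 = R ^ 2 ∧ (ζ = -1 → 0 < M.2)}

/-- The north pole. -/
def north (R : ℝ) : F4 := (0, R)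

/-- The cotangent bundle of the quadric, covectors being identified with tangent vectors by means
of the scalar product. -/
def cotangent (ζ R : ℝ) : Set QPhase := {y | y.1 ∈ quadric ζ R ∧ form ζ y.1 y.2 = 0}

/-- The cotangent bundle of the quadric, minus the zero section. -/
def cotangent₀ (ζ R : ℝ) : Set QPhase := {y | y ∈ cotangent ζ R ∧ y.2 ≠ 0}

/-- The cotangent bundle of the quadric deprived of its north pole, minus the zero section. -/
def cotangentPunctured₀ (ζ R : ℝ) : Set QPhase := {y | y ∈ cotangent₀ ζ R ∧ y.1 ≠ north R}

/-- The space of vectors tangent at `y = (M, W)` to the submanifold of equations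
`M · M = ζ R²`, `M · W = 0`, that is, to the cotangent bundle of the quadric. -/
def tangentAt (ζ : ℝ) (y : QPhase) : Submodule ℝ QPhase where
  carrier := {v | form ζ y.1 v.1 = 0 ∧ form ζ y.1 v.2 + form ζ v.1 y.2 = 0}
  zero_mem' := by simp [form]
  add_mem' := by
    rintro a b ⟨ha, ha'⟩ ⟨hb, hb'⟩
    simp only [form, Set.mem_ofPred_eq, Prod.fst_add, Prod.snd_add, inner_add_right,
      inner_add_left] at *
    constructor <;> linear_combination (norm := ring_nf) ha + hb
    linear_combination (norm := ring_nf) ha' + hb' - ha - hb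
  smul_mem' := by
    rintro c a ⟨ha, ha'⟩
    simp only [form, Set.mem_ofPred_eq, Prod.smul_fst, Prod.smul_snd, inner_smul_right,
      real_inner_smul_left, smul_eq_mul] at *
    constructor
    · linear_combination c * ha
    · linear_combination c * ha'

/-- The canonical symplectic form `d(W · dM)` of the cotangent bundle of the quadric (to be
evaluated on tangent vectors). -/
def omegaQ (ζ : ℝ) (u v : QPhase) : ℝ := form ζ u.2 v.1 - form ζ v.2 u.1

/-- The Hamiltonian `H = - ζ k² m³ / (2 R² ‖W‖²)`, with `‖W‖² = W · W`. -/
def HQ (ζ m k R : ℝ) (y : QPhase) : ℝ :=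
  -(ζ * k ^ 2 * m ^ 3) / (2 * R ^ 2 * form ζ y.2 y.2)

/-- The Hamiltonian vector field of `H`. -/
def XH (ζ m k R : ℝ) (y : QPhase) : QPhase :=
  hamVec (tangentAt ζ y) (omegaQ ζ) (fderiv ℝ (HQ ζ m k R) y)

/-- The conformal factor `g = R / (h - R)`. -/
def conformalFactor (R : ℝ) (y : QPhase) : ℝ := R / (y.1.2 - R)

/-- The antipodal map of the fibres of the cotangent bundle. -/
def fibreFlip (y : QPhase) : QPhase := (y.1, -y.2)

/-! ### The map `S⁻¹` -/

/-- The inverse of the (generalized) stereographic projection of the quadric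
`h² + ζ ‖μ‖² = ρ²` from its north pole onto `h = 0`, followed by the homothety of ratio `R / ρ`. -/
def invStereo (ζ R ρ : ℝ) (p : E3) : F4 :=
  ((2 * R * ρ / (ρ ^ 2 + ζ * ‖p‖ ^ 2)) • p,
    R * ((‖p‖ ^ 2 - ζ * ρ ^ 2) / (‖p‖ ^ 2 + ζ * ρ ^ 2)))

/-- The lift of `invStereo` to the cotangent bundles: the 1-form `r · dp` at `p` is sent to the
1-form `W · dM` at `M = invStereo ζ R ρ p` (see `cotangentLift_tangent` and
`cotangentLift_liouville`). -/
def cotangentLift (ζ R ρ : ℝ) (x : KPhase) : QPhase :=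
  (invStereo ζ R ρ x.2,
    (((ρ ^ 2 + ζ * ‖x.2‖ ^ 2) / (2 * R * ρ)) • x.1
        - (ζ * inner ℝ x.1 x.2 / (R * ρ)) • x.2,
      ζ * inner ℝ x.1 x.2 / R))

/-- The number `ρ > 0` such that `E(r, p) = - ζ ρ² / (2 m)`. -/
def energyRadius (ζ m k : ℝ) (x : KPhase) : ℝ := Real.sqrt (-(2 * m * ζ * energy m k x))

/-- The map `S⁻¹`, obtained by gluing the restrictions of the maps `cotangentLift ζ R ρ` to the
energy levels `E = - ζ ρ² / (2 m)`. -/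
def SInv (ζ m k R : ℝ) (x : KPhase) : QPhase := cotangentLift ζ R (energyRadius ζ m k x) x

/-- `M = invStereo ζ R ρ p` satisfies the equation of the quadric. -/
theorem invStereo_quadric {ζ R ρ : ℝ} (hζ : ζ = 1 ∨ ζ = -1) (p : E3)
    (hD : ρ ^ 2 + ζ * ‖p‖ ^ 2 ≠ 0) :
    (invStereo ζ R ρ p).2 ^ 2 + ζ * ‖(invStereo ζ R ρ p).1‖ ^ 2 = R ^ 2 := by
  have hζD : ‖p‖ ^ 2 + ζ * ρ ^ 2 = ζ * (ρ ^ 2 + ζ * ‖p‖ ^ 2) := by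
    rcases hζ with rfl | rfl <;> ring
  have hζ2 : ζ ^ 2 = 1 := by rcases hζ with rfl | rfl <;> norm_num
  have hζ0 : ζ ≠ 0 := by rcases hζ with rfl | rfl <;> norm_num
  simp only [invStereo, norm_smul, mul_pow, Real.norm_eq_abs, sq_abs, hζD]
  generalize hD' : ρ ^ 2 + ζ * ‖p‖ ^ 2 = D at *
  have hp : ‖p‖ ^ 2 = ζ * (D - ρ ^ 2) := by
    rw [← hD']; linear_combination (-‖p‖ ^ 2) * hζ2
  rw [hp]
  field_simp
  rcases hζ with rfl | rfl <;> ring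

/-- The line through the north pole `(0, R)` and `M = (μ, h)` meets `h = 0` at `(R / ρ) p`. -/
theorem invStereo_line {ζ R ρ : ℝ} (hζ : ζ = 1 ∨ ζ = -1) (p : E3)
    (hD : ρ ^ 2 + ζ * ‖p‖ ^ 2 ≠ 0) :
    (R - (invStereo ζ R ρ p).2) • p = ρ • (invStereo ζ R ρ p).1 := by
  have hζD : ‖p‖ ^ 2 + ζ * ρ ^ 2 = ζ * (ρ ^ 2 + ζ * ‖p‖ ^ 2) := by
    rcases hζ with rfl | rfl <;> ring
  have hζ2 : ζ ^ 2 = 1 := by rcases hζ with rfl | rfl <;> norm_num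
  have hζ0 : ζ ≠ 0 := by rcases hζ with rfl | rfl <;> norm_num
  simp only [invStereo, smul_smul, hζD]
  congr 1
  generalize hD' : ρ ^ 2 + ζ * ‖p‖ ^ 2 = D at *
  have hp : ‖p‖ ^ 2 = ζ * (D - ρ ^ 2) := by
    rw [← hD']; linear_combination (-‖p‖ ^ 2) * hζ2
  rw [hp]
  field_simp
  rcases hζ with rfl | rfl <;> ring

theorem cotangentLift_tangent {ζ R ρ : ℝ} (hζ : ζ = 1 ∨ ζ = -1) (hR : R ≠ 0) (hρ : ρ ≠ 0)
    (x : KPhase) (hD : ρ ^ 2 + ζ * ‖x.2‖ ^ 2 ≠ 0) :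
    form ζ (cotangentLift ζ R ρ x).1 (cotangentLift ζ R ρ x).2 = 0 := by
  simp only [cotangentLift, invStereo, form, inner_sub_right, inner_smul_right,
    real_inner_smul_left, real_inner_self_eq_norm_sq, real_inner_comm x.1 x.2]
  rcases hζ with rfl | rfl
  · have e : ‖x.2‖ ^ 2 + 1 * ρ ^ 2 = ρ ^ 2 + 1 * ‖x.2‖ ^ 2 := by ring
    rw [e]
    field_simp
    ring
  · have e : ‖x.2‖ ^ 2 + -1 * ρ ^ 2 = -(ρ ^ 2 + -1 * ‖x.2‖ ^ 2) := by ring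
    rw [e]
    field_simp
    ring

/-- `W · dM = r · dp`: the map `cotangentLift ζ R ρ` exchanges the Liouville forms. -/
theorem cotangentLift_liouville {ζ R ρ : ℝ} (hζ : ζ = 1 ∨ ζ = -1) (hR : R ≠ 0) (hρ : ρ ≠ 0)
    (x : KPhase) (hD : ρ ^ 2 + ζ * ‖x.2‖ ^ 2 ≠ 0) (v : E3) :
    ∃ d : F4, HasDerivAt (fun t : ℝ => invStereo ζ R ρ (x.2 + t • v)) d 0 ∧
      form ζ (cotangentLift ζ R ρ x).2 d = inner ℝ x.1 v := by
  obtain ⟨r, p⟩ := x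
  simp only at hD
  have hline : HasDerivAt (fun t : ℝ => p + t • v) v 0 := by
    simpa using ((hasDerivAt_id (0 : ℝ)).smul_const v).const_add p
  have hsq : HasDerivAt (fun t : ℝ => ‖p + t • v‖ ^ 2) (2 * inner ℝ p v) 0 := by
    simpa using hline.norm_sq
  have hD1 : HasDerivAt (fun t : ℝ => ρ ^ 2 + ζ * ‖p + t • v‖ ^ 2) (ζ * (2 * inner ℝ p v)) 0 :=
    (hsq.const_mul ζ).const_add _
  have hN : HasDerivAt (fun t : ℝ => ‖p + t • v‖ ^ 2 - ζ * ρ ^ 2) (2 * inner ℝ p v) 0 :=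
    hsq.sub_const _
  have hD2 : HasDerivAt (fun t : ℝ => ‖p + t • v‖ ^ 2 + ζ * ρ ^ 2) (2 * inner ℝ p v) 0 :=
    hsq.add_const _
  have hζD : ‖p‖ ^ 2 + ζ * ρ ^ 2 = ζ * (ρ ^ 2 + ζ * ‖p‖ ^ 2) := by
    rcases hζ with rfl | rfl <;> ring
  have hζ0 : ζ ≠ 0 := by rcases hζ with rfl | rfl <;> norm_num
  have hζ2 : ζ ^ 2 = 1 := by rcases hζ with rfl | rfl <;> norm_num
  have h0 : ρ ^ 2 + ζ * ‖p + (0 : ℝ) • v‖ ^ 2 ≠ 0 := by simpa using hD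
  have h0' : ‖p + (0 : ℝ) • v‖ ^ 2 + ζ * ρ ^ 2 ≠ 0 := by
    simpa using (hζD ▸ mul_ne_zero hζ0 hD : ‖p‖ ^ 2 + ζ * ρ ^ 2 ≠ 0)
  have hc := (((hasDerivAt_const (0 : ℝ) (2 * R * ρ)).fun_div hD1 h0).fun_smul hline)
  have hh := ((hN.fun_div hD2 h0').const_mul R)
  refine ⟨_, hc.prodMk hh, ?_⟩
  simp only [cotangentLift, form, zero_smul, add_zero, hζD, inner_add_right, inner_sub_left,
    inner_smul_right, real_inner_smul_left, real_inner_self_eq_norm_sq]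
  generalize hD' : ρ ^ 2 + ζ * ‖p‖ ^ 2 = D at *
  have hp : ‖p‖ ^ 2 = ζ * (D - ρ ^ 2) := by
    rw [← hD']; linear_combination (-‖p‖ ^ 2) * hζ2
  rw [hp]
  field_simp
  rcases hζ with rfl | rfl <;> ring

/-! ### The Györgyi-Ligon-Schaaf map -/

/-- `cos` if `ζ = 1`, `cosh` if `ζ = -1`. -/
def cs (ζ t : ℝ) : ℝ := if ζ = 1 then Real.cos t else Real.cosh t

/-- `sin` if `ζ = 1`, `sinh` if `ζ = -1`. -/
def sn (ζ t : ℝ) : ℝ := if ζ = 1 then Real.sin t else Real.sinh t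

/-- The Györgyi-Ligon-Schaaf map `(r, p) ↦ (ξ, η)`, with values in the cotangent bundle of the
unit sphere if `ζ = 1`, of one sheet of the unit two-sheeted hyperboloid if `ζ = -1`. Here
`ρ = √(-2 m ζ E(r, p))`, `K = m² k` and `φ = ρ (r · p) / K`. -/
def gls (ζ m k : ℝ) (x : KPhase) : QPhase :=
  let ρ := energyRadius ζ m k x
  let K := m ^ 2 * k
  let a : ℝ := inner ℝ x.1 x.2
  let φ := ρ * a / K
  let A : E3 := ‖x.1‖⁻¹ • x.1 - (a / K) • x.2
  let b : ℝ := ‖x.1‖ * ‖x.2‖ ^ 2 / K - 1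
  (((ζ * sn ζ φ) • A + (ζ * (ρ / K) * ‖x.1‖ * cs ζ φ) • x.2,
      ζ * (ρ / K) * a * sn ζ φ + b * cs ζ φ),
    (-(ζ * (K / ρ) * cs ζ φ) • A + (‖x.1‖ * sn ζ φ) • x.2,
      -(ζ * a * cs ζ φ) + ζ * (K / ρ) * b * sn ζ φ))

end Kepler

end

open Kepler

noncomputable section

namespace Kepler

open scoped Topology

/-! ### Smooth maps -/

section Smooth

variable {V V' V'' : Type*} [NormedAddCommGroup V] [NormedSpace ℝ V] [NormedAddCommGroup V']
  [NormedSpace ℝ V'] [NormedAddCommGroup V''] [NormedSpace ℝ V'']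

/-! Put K = m²k. On U_ζ the energy relation reads r(p² + ζρ²) = 2K. It turns S⁻¹ into a closed
formula (`SInv_eq`) with ‖W‖ = K/(Rρ), which gives H ∘ S⁻¹ = E. Since ρ is recovered from ‖W‖, the
inverse is explicit as well (`SMap`). The orbits of X_H are geodesics run at a frequency depending
on ‖W‖ only, so the flow is a rotation `rot` in the plane of M and W.

At the time s = -p·r/(2E) the rotation angle is τ = W_h/‖W‖ (`flowSInv_eq`), hence F is S⁻¹ followed
by `shift`. Inverting `shift` on an orbit means solving Kepler's equation t + τ(rot_t y) = 0. Its
left side has derivative 1 - h/R, which has constant sign and vanishes only over the north pole N.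
The root is therefore unique, and off N it is smooth by the implicit function theorem, so F maps U_ζ
diffeomorphically onto T*₀(Q ∖ {N}).

Symplecticity is a computation with Liouville forms. Because ρ varies, S⁻¹ pulls W·dM back to r·dp -
(r·p)dρ/ρ (`liouville_SInv`). The shift adds ζR‖W‖dτ = d(r·p) + (r·p)dρ/ρ (`liouville_shift`). The
terms in dρ cancel and r·dp + d(r·p) remains, whose differential is -d(p·dr). The flip W ↦ -W
restores the sign.

For the vector fields, S⁻¹ sends X_E to gX_H (`fderiv_SInv_XE`), of angular speed gλ, and τ then
varies at the rate -gλh/R. With g = R/(h - R) the total speed gλ(1 - h/R) is -λ. Hence F sends X_E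
to -X_H, and G sends it to X_H. -/

theorem exists_contDiffOn_of_contDiffAt {f : V → V'} {x : V} (h : ContDiffAt ℝ ω f x) :
    ∃ U : Set V, IsOpen U ∧ x ∈ U ∧ ContDiffOn ℝ ∞ f U := by
  -- Regularity `ω` matters here: `C^∞` at a point only provides, for each finite order, a
  -- neighbourhood depending on that order.
  obtain ⟨u, hu, hf⟩ := h.contDiffOn (m := ∞) le_top (by simp)
  obtain ⟨U, hUu, hU, hx⟩ := mem_nhds_iff.1 (by simpa using hu)
  exact ⟨U, hU, hx, hf.mono hUu⟩

theorem smoothOn_of_contDiffAt {f : V → V'} {s : Set V} (h : ∀ x ∈ s, ContDiffAt ℝ ω f x) :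
    SmoothOn f s := fun x hx => by
  obtain ⟨U, hU, hxU, hf⟩ := exists_contDiffOn_of_contDiffAt (h x hx)
  exact ⟨U, hU, hxU, f, hf, fun _ _ => rfl⟩

theorem SmoothOn.comp {f : V → V'} {g : V' → V''} {s : Set V} {t : Set V'}
    (hg : SmoothOn g t) (hf : SmoothOn f s) (h : Set.MapsTo f s t) : SmoothOn (g ∘ f) s := by
  intro x hx
  obtain ⟨U, hU, hxU, f', hf', hef⟩ := hf x hx
  obtain ⟨W, hW, hxW, g', hg', heg⟩ := hg (f x) (h hx)
  refine ⟨U ∩ f' ⁻¹' W, hf'.continuousOn.isOpen_inter_preimage hU hW, ⟨hxU, ?_⟩, g' ∘ f',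
    hg'.comp (hf'.mono Set.inter_subset_left) fun y hy => hy.2, ?_⟩
  · rw [Set.mem_preimage, ← hef ⟨hx, hxU⟩]; exact hxW
  · rintro y ⟨hys, hyU, hyW⟩
    have e : f y = f' y := hef ⟨hys, hyU⟩
    have : f y ∈ W := by rw [e]; exact hyW
    simp only [Function.comp_apply]
    rw [heg ⟨h hys, this⟩, e]

theorem isDiffeoOnto_of_invOn {f : V → V'} {g : V' → V} {A : Set V} {B : Set V'}
    (hf : SmoothOn f A) (hg : SmoothOn g B) (hfm : Set.MapsTo f A B) (hgm : Set.MapsTo g B A)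
    (h : Set.InvOn g f A B) : IsDiffeoOnto f A B :=
  ⟨h.bijOn hfm hgm, hf, g, hg, h⟩

end Smooth

/-! ### Trigonometric and hyperbolic functions -/

theorem cs_zero (ζ : ℝ) : cs ζ 0 = 1 := by unfold cs; split_ifs <;> simp
theorem sn_zero (ζ : ℝ) : sn ζ 0 = 0 := by unfold sn; split_ifs <;> simp
theorem cs_neg (ζ t : ℝ) : cs ζ (-t) = cs ζ t := by unfold cs; split_ifs <;> simp
theorem sn_neg (ζ t : ℝ) : sn ζ (-t) = -sn ζ t := by unfold sn; split_ifs <;> simp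

section Trig

variable {ζ : ℝ}

theorem sq_eq_one_of_sign (hζ : ζ = 1 ∨ ζ = -1) : ζ ^ 2 = 1 := by
  rcases hζ with rfl | rfl <;> norm_num

theorem ne_zero_of_sign (hζ : ζ = 1 ∨ ζ = -1) : ζ ≠ 0 := by
  rcases hζ with rfl | rfl <;> norm_num

theorem cs_sign_mul (hζ : ζ = 1 ∨ ζ = -1) (t : ℝ) : cs ζ (ζ * t) = cs ζ t := by
  rcases hζ with rfl | rfl
  · rw [one_mul]
  · rw [neg_one_mul, cs_neg]

theorem sn_sign_mul (hζ : ζ = 1 ∨ ζ = -1) (t : ℝ) : sn ζ (ζ * t) = ζ * sn ζ t := by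
  rcases hζ with rfl | rfl
  · rw [one_mul, one_mul]
  · rw [neg_one_mul, neg_one_mul, sn_neg]

theorem cs_sq_add_sn_sq (hζ : ζ = 1 ∨ ζ = -1) (t : ℝ) : cs ζ t ^ 2 + ζ * sn ζ t ^ 2 = 1 := by
  rcases hζ with rfl | rfl
  · simp [cs, sn]
  · norm_num [cs, sn]
    linarith [Real.cosh_sq t]

theorem cs_add (hζ : ζ = 1 ∨ ζ = -1) (s t : ℝ) :
    cs ζ (s + t) = cs ζ s * cs ζ t - ζ * (sn ζ s * sn ζ t) := by
  rcases hζ with rfl | rfl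
  · simp [cs, sn, Real.cos_add]
  · norm_num [cs, sn, Real.cosh_add]

theorem sn_add (hζ : ζ = 1 ∨ ζ = -1) (s t : ℝ) :
    sn ζ (s + t) = sn ζ s * cs ζ t + cs ζ s * sn ζ t := by
  rcases hζ with rfl | rfl
  · simp [cs, sn, Real.sin_add]
  · norm_num [cs, sn, Real.sinh_add]

theorem hasDerivAt_cs (hζ : ζ = 1 ∨ ζ = -1) (t : ℝ) : HasDerivAt (cs ζ) (-(ζ * sn ζ t)) t := by
  rcases hζ with rfl | rfl
  · have h : cs 1 = Real.cos := by funext t; simp [cs]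
    rw [h]
    simpa [sn] using Real.hasDerivAt_cos t
  · have h : cs (-1) = Real.cosh := by funext t; norm_num [cs]
    rw [h]
    norm_num [sn]
    exact Real.hasDerivAt_cosh t

theorem hasDerivAt_sn (hζ : ζ = 1 ∨ ζ = -1) (t : ℝ) : HasDerivAt (sn ζ) (cs ζ t) t := by
  rcases hζ with rfl | rfl
  · have h : sn 1 = Real.sin := by funext t; simp [sn]
    rw [h]
    simpa [cs] using Real.hasDerivAt_sin t
  · have h : sn (-1) = Real.sinh := by funext t; norm_num [sn]
    rw [h]
    norm_num [cs]
    exact Real.hasDerivAt_sinh t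

theorem contDiff_cs (ζ : ℝ) : ContDiff ℝ ω (cs ζ) := by
  by_cases h : ζ = 1
  · have : cs ζ = Real.cos := by funext t; simp [cs, h]
    rw [this]; exact Real.contDiff_cos
  · have : cs ζ = Real.cosh := by funext t; simp [cs, h]
    rw [this]; exact Real.contDiff_cosh

theorem contDiff_sn (ζ : ℝ) : ContDiff ℝ ω (sn ζ) := by
  by_cases h : ζ = 1
  · have : sn ζ = Real.sin := by funext t; simp [sn, h]
    rw [this]; exact Real.contDiff_sin
  · have : sn ζ = Real.sinh := by funext t; simp [sn, h]
    rw [this]; exact Real.contDiff_sinh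

end Trig

/-! ### The scalar product -/

section Form

variable (ζ : ℝ)

theorem form_comm (a b : F4) : form ζ a b = form ζ b a := by
  simp only [form, real_inner_comm, mul_comm]

theorem form_add_left (a b c : F4) : form ζ (a + b) c = form ζ a c + form ζ b c := by
  simp only [form, Prod.fst_add, Prod.snd_add, inner_add_left]; ring

theorem form_add_right (a b c : F4) : form ζ a (b + c) = form ζ a b + form ζ a c := by
  rw [form_comm, form_add_left, form_comm ζ b, form_comm ζ c]

theorem form_smul_left (t : ℝ) (a b : F4) : form ζ (t • a) b = t * form ζ a b := by
  simp only [form, Prod.smul_fst, Prod.smul_snd, real_inner_smul_left, smul_eq_mul]; ring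

theorem form_smul_right (t : ℝ) (a b : F4) : form ζ a (t • b) = t * form ζ a b := by
  rw [form_comm, form_smul_left, form_comm]

theorem form_neg_left (a b : F4) : form ζ (-a) b = -form ζ a b := by
  rw [← neg_one_smul ℝ, form_smul_left, neg_one_mul]

theorem form_neg_right (a b : F4) : form ζ a (-b) = -form ζ a b := by
  rw [form_comm, form_neg_left, form_comm]

theorem form_sub_left (a b c : F4) : form ζ (a - b) c = form ζ a c - form ζ b c := by
  rw [sub_eq_add_neg, form_add_left, form_neg_left, sub_eq_add_neg]

theorem form_sub_right (a b c : F4) : form ζ a (b - c) = form ζ a b - form ζ a c := by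
  rw [form_comm, form_sub_left, form_comm ζ b, form_comm ζ c]

@[simp] theorem form_zero_left (a : F4) : form ζ 0 a = 0 := by simp [form]
@[simp] theorem form_zero_right (a : F4) : form ζ a 0 = 0 := by simp [form]

theorem contDiff_form : ContDiff ℝ ω fun z : F4 × F4 => form ζ z.1 z.2 := by
  unfold form
  exact ((contDiff_fst.comp contDiff_fst).inner ℝ (contDiff_fst.comp contDiff_snd)).add
    (contDiff_const.mul ((contDiff_snd.comp contDiff_fst).mul (contDiff_snd.comp contDiff_snd)))

variable {ζ}

theorem hasDerivAt_fst_comp {V V' : Type*} [NormedAddCommGroup V] [NormedSpace ℝ V]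
    [NormedAddCommGroup V'] [NormedSpace ℝ V'] {f : ℝ → V × V'} {f' : V × V'} {t : ℝ}
    (hf : HasDerivAt f f' t) : HasDerivAt (fun s => (f s).1) f'.1 t :=
  (hasFDerivAt_fst (𝕜 := ℝ) (p := f t)).comp_hasDerivAt t hf

theorem hasDerivAt_snd_comp {V V' : Type*} [NormedAddCommGroup V] [NormedSpace ℝ V]
    [NormedAddCommGroup V'] [NormedSpace ℝ V'] {f : ℝ → V × V'} {f' : V × V'} {t : ℝ}
    (hf : HasDerivAt f f' t) : HasDerivAt (fun s => (f s).2) f'.2 t :=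
  (hasFDerivAt_snd (𝕜 := ℝ) (p := f t)).comp_hasDerivAt t hf

theorem hasDerivAt_form {f g : ℝ → F4} {f' g' : F4} {t : ℝ} (hf : HasDerivAt f f' t)
    (hg : HasDerivAt g g' t) :
    HasDerivAt (fun s => form ζ (f s) (g s)) (form ζ f' (g t) + form ζ (f t) g') t := by
  have h := ((hasDerivAt_fst_comp hf).inner ℝ (hasDerivAt_fst_comp hg)).add
    (((hasDerivAt_snd_comp hf).mul (hasDerivAt_snd_comp hg)).const_mul ζ)
  refine h.congr_deriv ?_
  simp only [form]; ring

/-- The reversed Cauchy-Schwarz inequality for vectors tangent to the hyperboloid; for the sphere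
the scalar product is definite. -/
theorem form_self_pos {R : ℝ} (hζ : ζ = 1 ∨ ζ = -1) (hR : 0 < R) {M W : F4}
    (hM : M.2 ^ 2 + ζ * ‖M.1‖ ^ 2 = R ^ 2) (hMW : form ζ M W = 0) (hW : W ≠ 0) :
    0 < form ζ W W := by
  simp only [form, real_inner_self_eq_norm_sq] at *
  have hne : W.1 ≠ 0 ∨ W.2 ≠ 0 := by
    by_contra! h; exact hW (Prod.ext h.1 h.2)
  rcases hζ with rfl | rfl
  · rcases hne with h | h
    · have := pow_pos (norm_pos_iff.2 h) 2
      nlinarith [sq_nonneg W.2]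
    · have := sq_pos_of_ne_zero h
      nlinarith [sq_nonneg ‖W.1‖]
  · have hM0 : 0 < M.2 ^ 2 := by nlinarith [sq_nonneg ‖M.1‖, pow_pos hR 2]
    have hW1 : W.1 ≠ 0 := by
      rintro h
      rw [h] at hMW
      simp at hMW
      rcases hMW with h' | h'
      · rw [h'] at hM0; simp at hM0
      · exact hne.elim (· h) (· h')
    have hn := norm_pos_iff.2 hW1
    have hcs := abs_real_inner_le_norm M.1 W.1
    have e : inner ℝ M.1 W.1 = M.2 * W.2 := by linarith
    rw [e] at hcs
    have h2 : (M.2 * W.2) ^ 2 ≤ (‖M.1‖ * ‖W.1‖) ^ 2 := by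
      rw [← sq_abs (M.2 * W.2)]; exact pow_le_pow_left₀ (abs_nonneg _) hcs 2
    have h3 : ‖M.1‖ ^ 2 = M.2 ^ 2 - R ^ 2 := by linarith
    rw [mul_pow, mul_pow, h3] at h2
    have h4 : 0 < M.2 ^ 2 * (‖W.1‖ ^ 2 - W.2 ^ 2) := by
      have : 0 < R ^ 2 * ‖W.1‖ ^ 2 := by positivity
      nlinarith
    have := pos_of_mul_pos_right h4 hM0.le
    linarith

end Form

/-! ### Derivatives along lines and Hamiltonian vectors -/

section Line

variable {V V' : Type*} [NormedAddCommGroup V] [NormedSpace ℝ V] [NormedAddCommGroup V']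
  [NormedSpace ℝ V']

theorem hasDerivAt_line (x v : V) : HasDerivAt (fun t : ℝ => x + t • v) v 0 := by
  simpa using ((hasDerivAt_id (0 : ℝ)).smul_const v).const_add x

theorem hasDerivAt_comp_line {f : V → V'} {x : V} (hf : DifferentiableAt ℝ f x) (v : V) :
    HasDerivAt (fun t : ℝ => f (x + t • v)) (fderiv ℝ f x v) 0 := by
  have hf' : HasFDerivAt f (fderiv ℝ f x) (x + (0 : ℝ) • v) := by simpa using hf.hasFDerivAt
  exact hf'.comp_hasDerivAt (0 : ℝ) (hasDerivAt_line x v)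

/-- Once differentiability is known, a differential is determined by derivatives along lines. The
explicit differentials below are obtained in this way, by one-variable calculus. -/
theorem fderiv_apply_eq {f : V → V'} {x : V} (hf : DifferentiableAt ℝ f x) {v : V} {d : V'}
    (h : HasDerivAt (fun t : ℝ => f (x + t • v)) d 0) : fderiv ℝ f x v = d :=
  (hasDerivAt_comp_line hf v).unique h

theorem hamVec_eq {T : Submodule ℝ V} {σ : V → V → ℝ} {dH : V →L[ℝ] ℝ} {X : V}
    (hX : IsHamVec T σ dH X) (huniq : ∀ Y, IsHamVec T σ dH Y → Y = X) : hamVec T σ dH = X :=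
  huniq _ (Classical.epsilon_spec ⟨X, hX⟩)

end Line

/-! ### The Kepler vector field -/

section KeplerField

variable {m k : ℝ} {x : KPhase}

theorem hasDerivAt_norm_line {r : E3} (hr : r ≠ 0) (v : E3) :
    HasDerivAt (fun t : ℝ => ‖r + t • v‖) (inner ℝ r v / ‖r‖) 0 := by
  have h : HasDerivAt (fun t : ℝ => ‖r + t • v‖ ^ 2) (2 * inner ℝ r v) 0 := by
    simpa using (hasDerivAt_line r v).norm_sq
  have h0 : ‖r + (0 : ℝ) • v‖ ^ 2 ≠ 0 := by simpa using hr
  have := h.sqrt h0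
  simp only [Real.sqrt_sq (norm_nonneg _)] at this
  refine this.congr_deriv ?_
  simp only [zero_smul, add_zero]
  field_simp

theorem hasDerivAt_norm_sq_line (p v : E3) :
    HasDerivAt (fun t : ℝ => ‖p + t • v‖ ^ 2) (2 * inner ℝ p v) 0 := by
  simpa using (hasDerivAt_line p v).norm_sq

theorem contDiffAt_energy (hx : x.1 ≠ 0) : ContDiffAt ℝ ω (energy m k) x := by
  unfold energy
  exact ((contDiffAt_snd.norm_sq ℝ).div_const _).sub
    (contDiffAt_const.div (contDiffAt_fst.norm ℝ hx) (norm_ne_zero_iff.2 hx))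

theorem hasDerivAt_energy_line (hm : m ≠ 0) (hx : x.1 ≠ 0) (v : KPhase) :
    HasDerivAt (fun t : ℝ => energy m k (x + t • v))
      (inner ℝ x.2 v.2 / m + m * k * inner ℝ x.1 v.1 / ‖x.1‖ ^ 3) 0 := by
  have h1 := (hasDerivAt_norm_sq_line x.2 v.2).div_const (2 * m)
  have h2 := (hasDerivAt_const (0 : ℝ) (m * k)).fun_div (hasDerivAt_norm_line hx v.1)
    (by simpa using hx)
  refine (h1.fun_sub h2).congr_deriv ?_
  simp only [zero_smul, add_zero]
  field_simp
  ring

theorem fderiv_energy (hm : m ≠ 0) (hx : x.1 ≠ 0) (v : KPhase) :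
    fderiv ℝ (energy m k) x v = inner ℝ x.2 v.2 / m + m * k * inner ℝ x.1 v.1 / ‖x.1‖ ^ 3 :=
  fderiv_apply_eq ((contDiffAt_energy hx).differentiableAt (by simp)) (hasDerivAt_energy_line hm hx v)

theorem isHamVec_energy (hm : m ≠ 0) (hx : x.1 ≠ 0) :
    IsHamVec ⊤ omegaK (fderiv ℝ (energy m k) x)
      ((1 / m) • x.2, -(k * m / ‖x.1‖ ^ 3) • x.1) := by
  refine ⟨trivial, fun v _ => ?_⟩
  rw [fderiv_energy hm hx]
  simp only [omegaK, real_inner_smul_left, inner_smul_right, real_inner_comm x.2 v.2]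
  ring

theorem isHamVec_omegaK_unique {dH : KPhase →L[ℝ] ℝ} {X Y : KPhase}
    (hX : IsHamVec ⊤ omegaK dH X) (hY : IsHamVec ⊤ omegaK dH Y) : X = Y := by
  have h : ∀ v : KPhase, omegaK (X - Y) v = 0 := fun v => by
    have h1 := hX.2 v trivial
    have h2 := hY.2 v trivial
    simp only [omegaK, Prod.fst_sub, Prod.snd_sub, inner_sub_left, inner_sub_right] at *
    linarith
  have h1 := h (X.2 - Y.2, 0)
  have h2 := h (0, X.1 - Y.1)
  simp [omegaK, sub_eq_zero] at h1 h2
  exact Prod.ext h2 h1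

theorem XE_eq (hm : m ≠ 0) (hx : x.1 ≠ 0) :
    XE m k x = ((1 / m) • x.2, -(k * m / ‖x.1‖ ^ 3) • x.1) :=
  hamVec_eq (isHamVec_energy hm hx) fun _ hY => isHamVec_omegaK_unique hY (isHamVec_energy hm hx)

end KeplerField

/-! ### Geometry of the cotangent bundle of the quadric -/

section Quadric

variable {ζ m k R : ℝ} {y : QPhase}

/-- The norm `‖W‖` of a covector. -/
def covNorm (ζ : ℝ) (y : QPhase) : ℝ := Real.sqrt (form ζ y.2 y.2)

theorem form_quadric (hζ : ζ = 1 ∨ ζ = -1) {M : F4} (hM : M ∈ quadric ζ R) :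
    form ζ M M = ζ * R ^ 2 := by
  have h := hM.1
  simp only [form, real_inner_self_eq_norm_sq]
  linear_combination ζ * h - ‖M.1‖ ^ 2 * sq_eq_one_of_sign hζ

theorem form_cov_pos (hζ : ζ = 1 ∨ ζ = -1) (hR : 0 < R) (hy : y ∈ cotangent₀ ζ R) :
    0 < form ζ y.2 y.2 := form_self_pos hζ hR hy.1.1.1 hy.1.2 hy.2

theorem covNorm_pos (hζ : ζ = 1 ∨ ζ = -1) (hR : 0 < R) (hy : y ∈ cotangent₀ ζ R) :
    0 < covNorm ζ y := Real.sqrt_pos.2 (form_cov_pos hζ hR hy)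

theorem covNorm_sq (hζ : ζ = 1 ∨ ζ = -1) (hR : 0 < R) (hy : y ∈ cotangent₀ ζ R) :
    form ζ y.2 y.2 = covNorm ζ y ^ 2 := (Real.sq_sqrt (form_cov_pos hζ hR hy).le).symm

theorem contDiffAt_form_cov : ContDiffAt ℝ ω (fun y : QPhase => form ζ y.2 y.2) y :=
  ((contDiff_form ζ).comp (contDiff_snd.prodMk contDiff_snd)).contDiffAt

theorem contDiffAt_covNorm (h : form ζ y.2 y.2 ≠ 0) : ContDiffAt ℝ ω (covNorm ζ) y :=
  contDiffAt_form_cov.sqrt h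

theorem contDiffAt_HQ (hR : R ≠ 0) (h : form ζ y.2 y.2 ≠ 0) :
    ContDiffAt ℝ ω (HQ ζ m k R) y := by
  unfold HQ
  exact contDiffAt_const.div (contDiffAt_const.mul contDiffAt_form_cov)
    (mul_ne_zero (mul_ne_zero two_ne_zero (pow_ne_zero 2 hR)) h)

theorem fderiv_HQ (hR : R ≠ 0) (h : form ζ y.2 y.2 ≠ 0) (v : QPhase) :
    fderiv ℝ (HQ ζ m k R) y v =
      ζ * k ^ 2 * m ^ 3 * form ζ y.2 v.2 / (R ^ 2 * form ζ y.2 y.2 ^ 2) := by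
  refine fderiv_apply_eq ((contDiffAt_HQ hR h).differentiableAt (by simp)) ?_
  have h1 : HasDerivAt (fun t : ℝ => form ζ (y + t • v).2 (y + t • v).2)
      (form ζ v.2 y.2 + form ζ y.2 v.2) 0 := by
    have := hasDerivAt_snd_comp (hasDerivAt_line y v)
    simpa using hasDerivAt_form (ζ := ζ) this this
  have h2 := (hasDerivAt_const (0 : ℝ) (-(ζ * k ^ 2 * m ^ 3))).fun_div
    (h1.const_mul (2 * R ^ 2)) (by simpa using ⟨hR, h⟩)
  refine h2.congr_deriv ?_
  simp only [zero_smul, add_zero, form_comm ζ v.2]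
  field_simp
  ring

/-- The frequency `λ` of the orbits of the Hamiltonian `H`. -/
def freq (ζ m k R : ℝ) (y : QPhase) : ℝ := k ^ 2 * m ^ 3 / (R ^ 3 * covNorm ζ y ^ 3)

/-- An explicit expression of the Hamiltonian vector field of `H`. -/
def XHvec (ζ m k R : ℝ) (y : QPhase) : QPhase :=
  ((ζ * freq ζ m k R y * (R / covNorm ζ y)) • y.2, -(freq ζ m k R y * (covNorm ζ y / R)) • y.1)

/-- H depends on W only, which fixes the first component of the field as a multiple of W. The second
is a multiple of M, invisible to the symplectic form since M · v.1 = 0, and its coefficient is the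
one that makes the field tangent. -/
theorem isHamVec_HQ (hζ : ζ = 1 ∨ ζ = -1) (hR : 0 < R) (hy : y ∈ cotangent₀ ζ R) :
    IsHamVec (tangentAt ζ y) (omegaQ ζ) (fderiv ℝ (HQ ζ m k R) y) (XHvec ζ m k R y) := by
  have hww := covNorm_sq hζ hR hy
  have hM := form_quadric hζ hy.1.1
  have hMW := hy.1.2
  refine ⟨⟨?_, ?_⟩, fun v hv => ?_⟩
  · simp only [XHvec, form_smul_right, hMW, mul_zero]
  · simp only [XHvec, form_smul_right, form_smul_left, hww, hM]
    field_simp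
    ring
  · have hv1 : form ζ y.1 v.1 = 0 := hv.1
    rw [fderiv_HQ hR.ne' (form_cov_pos hζ hR hy).ne']
    simp only [omegaQ, XHvec, form_smul_left, hww, hv1, freq, form_comm ζ v.2]
    field_simp
    ring

/-- Nondegeneracy on the tangent space: the scalar product is positive definite on the orthogonal
complement of M (`form_self_pos`), even in the Lorentzian case. So it is enough to find tangent
vectors that pair with D to D.1 · D.1 and D.2 · D.2 up to sign. -/
theorem isHamVec_omegaQ_unique (hζ : ζ = 1 ∨ ζ = -1) (hR : 0 < R) (hy : y ∈ cotangent ζ R)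
    {dH : QPhase →L[ℝ] ℝ} {X Y : QPhase} (hX : IsHamVec (tangentAt ζ y) (omegaQ ζ) dH X)
    (hY : IsHamVec (tangentAt ζ y) (omegaQ ζ) dH Y) : X = Y := by
  have hζ0 := ne_zero_of_sign hζ
  have hD := (tangentAt ζ y).sub_mem hX.1 hY.1
  have h : ∀ v ∈ tangentAt ζ y, omegaQ ζ (X - Y) v = 0 := fun v hv => by
    have h1 := hX.2 v hv
    have h2 := hY.2 v hv
    simp only [omegaQ, Prod.fst_sub, Prod.snd_sub, form_sub_left, form_sub_right] at *
    linarith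
  obtain ⟨D, rfl⟩ : ∃ D, X = D + Y := ⟨X - Y, (sub_add_cancel X Y).symm⟩
  rw [add_sub_cancel_right] at h hD
  have hD1 : form ζ y.1 D.1 = 0 := hD.1
  have hD2 : form ζ y.1 D.2 + form ζ D.1 y.2 = 0 := hD.2
  have z1 : D.1 = 0 := by
    by_contra hne
    have hpos := form_self_pos hζ hR hy.1.1 hD1 hne
    have := h (0, D.1) ⟨by simp, by simpa using hD1⟩
    simp only [omegaQ, form_zero_right] at this
    linarith
  have hD2' : form ζ y.1 D.2 = 0 := by simpa [z1] using hD2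
  have z2 : D.2 = 0 := by
    by_contra hne
    have hpos := form_self_pos hζ hR hy.1.1 hD2' hne
    -- The multiple of M corrects (D.2, 0) into a tangent vector; it does not contribute to the
    -- pairing because D.1 = 0.
    have := h (D.2, (-(form ζ D.2 y.2) / (ζ * R ^ 2)) • y.1) ⟨hD2', by
      simp only [form_smul_right, form_quadric hζ hy.1]
      field_simp
      ring⟩
    simp only [omegaQ, z1, form_zero_right] at this
    linarith
  rw [show D = 0 from Prod.ext z1 z2, zero_add]

theorem XH_eq (hζ : ζ = 1 ∨ ζ = -1) (hR : 0 < R) (hy : y ∈ cotangent₀ ζ R) :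
    XH ζ m k R y = XHvec ζ m k R y :=
  hamVec_eq (isHamVec_HQ hζ hR hy) fun _ hY =>
    isHamVec_omegaQ_unique hζ hR hy.1 hY (isHamVec_HQ hζ hR hy)

/-- Cauchy-Schwarz in ℝ³ for the components of M and W, whose inner product is h W_h by
orthogonality. The resulting strict bound keeps rotated points on the upper sheet and makes
hyperbolic Kepler's equation solvable. -/
theorem sq_cov_height_le (hR : 0 < R) (hy : y ∈ cotangent₀ (-1) R) :
    R ^ 2 * (covNorm (-1) y ^ 2 + y.2.2 ^ 2) ≤ y.1.2 ^ 2 * covNorm (-1) y ^ 2 := by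
  have hζ : (-1 : ℝ) = 1 ∨ (-1 : ℝ) = -1 := Or.inr rfl
  rw [← covNorm_sq hζ hR hy]
  have hMW := hy.1.2
  have hM := hy.1.1.1
  simp only [form, real_inner_self_eq_norm_sq] at *
  have hcs := abs_real_inner_le_norm y.1.1 y.2.1
  have e : inner ℝ y.1.1 y.2.1 = y.1.2 * y.2.2 := by linarith
  rw [e] at hcs
  have h2 : (y.1.2 * y.2.2) ^ 2 ≤ (‖y.1.1‖ * ‖y.2.1‖) ^ 2 := by
    rw [← sq_abs (y.1.2 * y.2.2)]; exact pow_le_pow_left₀ (abs_nonneg _) hcs 2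
  have h3 : ‖y.1.1‖ ^ 2 = y.1.2 ^ 2 - R ^ 2 := by linarith
  rw [mul_pow, mul_pow, h3] at h2
  linarith

theorem abs_cov_height_lt (hR : 0 < R) (hy : y ∈ cotangent₀ (-1) R) :
    |y.2.2 / covNorm (-1) y| < y.1.2 / R := by
  have hw := covNorm_pos (Or.inr rfl) hR hy
  have h0 := hy.1.1.2 rfl
  have h := sq_cov_height_le hR hy
  refine abs_lt_of_sq_lt_sq ?_ (by positivity)
  rw [div_pow, div_pow, div_lt_div_iff₀ (by positivity) (by positivity)]
  nlinarith [pow_pos hw 2, pow_pos hR 2, mul_pos (pow_pos hw 2) (pow_pos hR 2)]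

/-- Both the denominator R - h in `SMap` and the derivative 1 - h/R in Kepler's equation thus
degenerate only at the north pole. -/
theorem height_eq_iff {M : F4} (hζ : ζ = 1 ∨ ζ = -1) (hM : M ∈ quadric ζ R) :
    M.2 = R ↔ M = north R := by
  refine ⟨fun h => Prod.ext ?_ h, fun h => by rw [h]; rfl⟩
  have := hM.1
  rw [h] at this
  have : ζ * ‖M.1‖ ^ 2 = 0 := by linarith
  change M.1 = 0
  simpa [ne_zero_of_sign hζ] using this

theorem sign_mul_height_le (hζ : ζ = 1 ∨ ζ = -1) (hR : 0 < R) {M : F4} (hM : M ∈ quadric ζ R) :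
    0 ≤ ζ * (R - M.2) := by
  have h := hM.1
  rcases hζ with rfl | rfl
  · have : M.2 ≤ R := abs_le_of_sq_le_sq' (by nlinarith [sq_nonneg ‖M.1‖]) hR.le |>.2
    linarith
  · have : R ≤ M.2 :=
      abs_le_of_sq_le_sq' (by nlinarith [sq_nonneg ‖M.1‖]) (hM.2 rfl).le |>.2
    linarith

end Quadric

/-! ### The geodesic rotations and the flow -/

section Rotation

variable {ζ m k R : ℝ} {y : QPhase}

/-- Rotation by the angle `τ` in the plane of `M` and `W`, the ratio of the lengths of `M` and `W`
being `c`. -/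
def rot (ζ c τ : ℝ) (y : QPhase) : QPhase :=
  (cs ζ τ • y.1 + (ζ * c * sn ζ τ) • y.2, -(c⁻¹ * sn ζ τ) • y.1 + cs ζ τ • y.2)

theorem rot_zero (ζ c : ℝ) (y : QPhase) : rot ζ c 0 y = y := by
  simp [rot, cs_zero, sn_zero]

theorem rot_rot (hζ : ζ = 1 ∨ ζ = -1) {c : ℝ} (hc : c ≠ 0) (σ τ : ℝ) (y : QPhase) :
    rot ζ c σ (rot ζ c τ y) = rot ζ c (σ + τ) y := by
  simp only [rot, cs_add hζ, sn_add hζ]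
  refine Prod.ext ?_ ?_
  · simp only
    match_scalars <;> field_simp <;> ring
  · simp only
    match_scalars <;> field_simp <;> ring

theorem hasDerivAt_rot (hζ : ζ = 1 ∨ ζ = -1) {c : ℝ} (hc : c ≠ 0) (τ : ℝ) (y : QPhase) :
    HasDerivAt (fun t => rot ζ c t y) ((ζ * c) • (rot ζ c τ y).2, -(c⁻¹) • (rot ζ c τ y).1) τ := by
  have hd := hasDerivAt_cs hζ τ
  have hs := hasDerivAt_sn hζ τ
  have h := ((hd.smul_const y.1).add ((hs.const_mul (ζ * c)).smul_const y.2)).prodMk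
    (((hs.const_mul c⁻¹).neg.smul_const y.1).add (hd.smul_const y.2))
  refine h.congr_deriv ?_
  simp only [rot]
  refine Prod.ext ?_ ?_
  · simp only
    match_scalars <;> field_simp
  · simp only
    match_scalars <;> field_simp

/-- The order `n` is left free: it is `ω` for the flow and the shift, but `∞` for `unshift`, whose
angle is only known to be smooth. -/
theorem contDiffAt_rot {V : Type*} [NormedAddCommGroup V] [NormedSpace ℝ V] {n : WithTop ℕ∞}
    {c τ : V → ℝ} {f : V → QPhase} {x : V} (hc : ContDiffAt ℝ n c x) (hτ : ContDiffAt ℝ n τ x)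
    (hf : ContDiffAt ℝ n f x) (h0 : c x ≠ 0) :
    ContDiffAt ℝ n (fun z => rot ζ (c z) (τ z) (f z)) x := by
  have h3 : ContDiffAt ℝ n (fun z => (f z).1) x := contDiffAt_fst.comp x hf
  have h4 : ContDiffAt ℝ n (fun z => (f z).2) x := contDiffAt_snd.comp x hf
  have hcs := ((contDiff_cs ζ).of_le le_top).contDiffAt.comp x hτ
  have hsn := ((contDiff_sn ζ).of_le le_top).contDiffAt.comp x hτ
  exact ((hcs.smul h3).add (((contDiffAt_const.mul hc).mul hsn).smul h4)).prodMk
    ((((hc.inv h0).mul hsn).neg.smul h3).add (hcs.smul h4))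

theorem rot_form (hζ : ζ = 1 ∨ ζ = -1) (hR : 0 < R) (hy : y ∈ cotangent₀ ζ R) (τ : ℝ) :
    form ζ (rot ζ (R / covNorm ζ y) τ y).1 (rot ζ (R / covNorm ζ y) τ y).1 = ζ * R ^ 2 ∧
    form ζ (rot ζ (R / covNorm ζ y) τ y).1 (rot ζ (R / covNorm ζ y) τ y).2 = 0 ∧
    form ζ (rot ζ (R / covNorm ζ y) τ y).2 (rot ζ (R / covNorm ζ y) τ y).2 = covNorm ζ y ^ 2 := by
  have hw := covNorm_pos hζ hR hy
  have hww := covNorm_sq hζ hR hy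
  have hM := form_quadric hζ hy.1.1
  have hMW := hy.1.2
  have hWM : form ζ y.2 y.1 = 0 := by rw [form_comm]; exact hMW
  have hcs := cs_sq_add_sn_sq hζ τ
  simp only [rot, form_add_left, form_add_right, form_smul_left, form_smul_right, hM, hMW, hWM,
    hww]
  generalize covNorm ζ y = w at *
  refine ⟨?_, ?_, ?_⟩
  · field_simp
    linear_combination ζ * (R * w) * hcs
  · field_simp
    ring
  · field_simp
    linear_combination R * w * hcs

theorem rot_mem (hζ : ζ = 1 ∨ ζ = -1) (hR : 0 < R) (hy : y ∈ cotangent₀ ζ R) (τ : ℝ) :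
    rot ζ (R / covNorm ζ y) τ y ∈ cotangent₀ ζ R := by
  obtain ⟨h1, h2, h3⟩ := rot_form hζ hR hy τ
  have hw := covNorm_pos hζ hR hy
  refine ⟨⟨⟨?_, ?_⟩, h2⟩, ?_⟩
  · simp only [form, real_inner_self_eq_norm_sq] at h1
    have hz := sq_eq_one_of_sign hζ
    linear_combination ζ * h1 - (((rot ζ (R / covNorm ζ y) τ y).1.2 ^ 2) - R ^ 2) * hz
  · rintro rfl
    have h := abs_cov_height_lt hR hy
    have hch : Real.sinh τ ≤ Real.cosh τ ∧ -Real.sinh τ ≤ Real.cosh τ := by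
      constructor
      · linarith [Real.cosh_sub_sinh τ, Real.exp_pos (-τ)]
      · linarith [Real.cosh_add_sinh τ, Real.exp_pos τ]
    have hc0 : 0 < Real.cosh τ := Real.cosh_pos τ
    have habs : |Real.sinh τ| ≤ Real.cosh τ := abs_le.2 ⟨by linarith [hch.2], hch.1⟩
    -- Positivity of the height follows from |sinh τ| ≤ cosh τ and |W_h| / ‖W‖ < h / R.
    have e : (rot (-1) (R / covNorm (-1) y) τ y).1.2 =
        R * (Real.cosh τ * (y.1.2 / R) - Real.sinh τ * (y.2.2 / covNorm (-1) y)) := by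
      norm_num [rot, cs, sn]
      field_simp
      ring
    rw [e]
    refine mul_pos hR (sub_pos.2 ?_)
    calc Real.sinh τ * (y.2.2 / covNorm (-1) y)
        ≤ |Real.sinh τ| * |y.2.2 / covNorm (-1) y| := by rw [← abs_mul]; exact le_abs_self _
      _ ≤ Real.cosh τ * |y.2.2 / covNorm (-1) y| :=
          mul_le_mul_of_nonneg_right habs (abs_nonneg _)
      _ < Real.cosh τ * (y.1.2 / R) := mul_lt_mul_of_pos_left h hc0
  · intro h
    rw [h] at h3
    rw [form_zero_left] at h3
    exact (pow_pos hw 2).ne h3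

theorem covNorm_rot (hζ : ζ = 1 ∨ ζ = -1) (hR : 0 < R) (hy : y ∈ cotangent₀ ζ R) (τ : ℝ) :
    covNorm ζ (rot ζ (R / covNorm ζ y) τ y) = covNorm ζ y := by
  rw [covNorm, (rot_form hζ hR hy τ).2.2, Real.sqrt_sq (covNorm_pos hζ hR hy).le]

/-- The flow of the Hamiltonian vector field of `H`. -/
def flow (ζ m k R s : ℝ) (y : QPhase) : QPhase :=
  rot ζ (R / covNorm ζ y) (freq ζ m k R y * s) y

theorem contDiffAt_freq (hR : R ≠ 0) (h : 0 < form ζ y.2 y.2) :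
    ContDiffAt ℝ ω (freq ζ m k R) y :=
  contDiffAt_const.div (contDiffAt_const.mul ((contDiffAt_covNorm h.ne').pow 3))
    (mul_ne_zero (pow_ne_zero 3 hR) (pow_ne_zero 3 (Real.sqrt_pos.2 h).ne'))

theorem contDiffAt_flow (hR : R ≠ 0) (h : 0 < form ζ y.2 y.2) (s : ℝ) :
    ContDiffAt ℝ ω (fun z : ℝ × QPhase => flow ζ m k R z.1 z.2) (s, y) := by
  have hw : covNorm ζ y ≠ 0 := (Real.sqrt_pos.2 h).ne'
  have hN : ContDiffAt ℝ ω (fun z : ℝ × QPhase => covNorm ζ z.2) (s, y) :=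
    ContDiffAt.comp (s, y) (g := covNorm ζ) (contDiffAt_covNorm h.ne') contDiffAt_snd
  have hF : ContDiffAt ℝ ω (fun z : ℝ × QPhase => freq ζ m k R z.2) (s, y) :=
    ContDiffAt.comp (s, y) (g := freq ζ m k R) (contDiffAt_freq hR h) contDiffAt_snd
  have hc : ContDiffAt ℝ ω (fun z : ℝ × QPhase => R / covNorm ζ z.2) (s, y) :=
    contDiffAt_const.div hN hw
  exact contDiffAt_rot hc (hF.mul contDiffAt_fst) contDiffAt_snd (div_ne_zero hR hw)

theorem flow_mem (hζ : ζ = 1 ∨ ζ = -1) (hR : 0 < R) (hy : y ∈ cotangent₀ ζ R) (s : ℝ) :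
    flow ζ m k R s y ∈ cotangent₀ ζ R := rot_mem hζ hR hy _

theorem hasDerivAt_flow (hζ : ζ = 1 ∨ ζ = -1) (hR : 0 < R) (hy : y ∈ cotangent₀ ζ R) (s : ℝ) :
    HasDerivAt (fun u => flow ζ m k R u y) (XH ζ m k R (flow ζ m k R s y)) s := by
  rw [XH_eq hζ hR (flow_mem hζ hR hy s)]
  have hw := covNorm_pos hζ hR hy
  have hc : R / covNorm ζ y ≠ 0 := (div_pos hR hw).ne'
  have h := (hasDerivAt_rot hζ hc (freq ζ m k R y * s) y).scomp s
    ((hasDerivAt_id s).const_mul (freq ζ m k R y))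
  refine h.congr_deriv ?_
  have e : covNorm ζ (flow ζ m k R s y) = covNorm ζ y := covNorm_rot hζ hR hy _
  have e' : freq ζ m k R (flow ζ m k R s y) = freq ζ m k R y := by rw [freq, e, freq]
  simp only [XHvec, e, e', inv_div, mul_one]
  refine Prod.ext ?_ ?_
  · simp only [flow, Prod.smul_mk, smul_smul]
    congr 1; ring
  · simp only [flow, Prod.smul_mk, smul_smul]
    congr 1; ring

theorem eq_of_hasDerivAt_zero {V : Type*} [NormedAddCommGroup V] [NormedSpace ℝ V] {I : Set ℝ}
    {f : ℝ → V} (hI : IsOpen I) (hI' : I.OrdConnected) (h : ∀ s ∈ I, HasDerivAt f 0 s) {s t : ℝ}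
    (hs : s ∈ I) (ht : t ∈ I) : f s = f t := by
  refine hI.is_const_of_deriv_eq_zero hI'.isPreconnected
    (fun u hu => (h u hu).differentiableAt.differentiableWithinAt) (fun u hu => (h u hu).deriv) hs ht

/-- Since ‖W‖ is conserved, the frequency l is constant along γ. Undoing the rotation by the angle l
t then gives a curve of zero derivative, which is constant on the interval. -/
theorem flow_unique (hζ : ζ = 1 ∨ ζ = -1) (hR : 0 < R) {I : Set ℝ}
    {γ : ℝ → QPhase} (hI : IsOpen I) (hI' : I.OrdConnected) (h0 : (0 : ℝ) ∈ I)
    (hγ : ∀ s ∈ I, γ s ∈ cotangent₀ ζ R ∧ HasDerivAt γ (XH ζ m k R (γ s)) s) {s : ℝ}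
    (hs : s ∈ I) : γ s = flow ζ m k R s (γ 0) := by
  have hconst : ∀ t ∈ I, form ζ (γ t).2 (γ t).2 = form ζ (γ 0).2 (γ 0).2 := fun t ht => by
    refine eq_of_hasDerivAt_zero (f := fun t => form ζ (γ t).2 (γ t).2) hI hI' (fun u hu => ?_) ht h0
    obtain ⟨hm, hd⟩ := hγ u hu
    have h2 := hasDerivAt_snd_comp hd
    refine (hasDerivAt_form (ζ := ζ) h2 h2).congr_deriv ?_
    rw [XH_eq hζ hR hm]
    simp only [XHvec, form_smul_left, form_smul_right, form_comm ζ (γ u).2 (γ u).1, hm.1.2]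
    simp
  have hcov : ∀ t ∈ I, covNorm ζ (γ t) = covNorm ζ (γ 0) := fun t ht => by
    rw [covNorm, hconst t ht, covNorm]
  have hfr : ∀ t ∈ I, freq ζ m k R (γ t) = freq ζ m k R (γ 0) := fun t ht => by
    rw [freq, hcov t ht, freq]
  have hw := covNorm_pos hζ hR (hγ 0 h0).1
  set w := covNorm ζ (γ 0) with hwdef
  set l := freq ζ m k R (γ 0) with hl
  have hc : R / w ≠ 0 := (div_pos hR hw).ne'
  have key : ∀ t ∈ I, HasDerivAt (fun t => rot ζ (R / w) (-(l * t)) (γ t)) 0 t := fun t ht => by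
    obtain ⟨hm, hd⟩ := hγ t ht
    rw [XH_eq hζ hR hm] at hd
    have d1 := hasDerivAt_fst_comp hd
    have d2 := hasDerivAt_snd_comp hd
    have hlin : HasDerivAt (fun t : ℝ => -(l * t)) (-l) t := by
      simpa using ((hasDerivAt_id t).const_mul l).fun_neg
    have hcs := (hasDerivAt_cs hζ (-(l * t))).comp t hlin
    have hsn := (hasDerivAt_sn hζ (-(l * t))).comp t hlin
    have h := ((hcs.smul d1).add ((hsn.const_mul (ζ * (R / w))).smul d2)).prodMk
      (((hsn.const_mul (R / w)⁻¹).neg.smul d1).add (hcs.smul d2))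
    refine h.congr_deriv ?_
    simp only [XHvec, hcov t ht, hfr t ht, Function.comp_apply, Pi.neg_apply]
    refine Prod.ext ?_ ?_
    · simp only [Prod.fst_zero]
      match_scalars <;> field_simp <;> ring
    · simp only [Prod.snd_zero]
      match_scalars <;> field_simp <;> ring
  have h1 := eq_of_hasDerivAt_zero hI hI' key hs h0
  simp only [mul_zero, neg_zero, rot_zero] at h1
  rw [flow, ← hwdef, ← hl, ← h1, rot_rot hζ hc, add_neg_cancel, rot_zero]

theorem isCompleteFlow_flow (hζ : ζ = 1 ∨ ζ = -1) (hR : 0 < R) :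
    IsCompleteFlow (cotangent₀ ζ R) (XH ζ m k R) (flow ζ m k R) where
  zero y _ := by rw [flow, mul_zero, rot_zero]
  mem y hy s := flow_mem hζ hR hy s
  hasDerivAt y hy s := hasDerivAt_flow hζ hR hy s
  smooth := smoothOn_of_contDiffAt fun z hz =>
    contDiffAt_flow hR.ne' (form_cov_pos hζ hR hz.2) z.1
  unique y _ I γ hI hI' h0 hy hγ s hs := by
    rw [← hy]; exact flow_unique hζ hR hI hI' h0 hγ hs

end Rotation

/-! ### Kepler's equation -/

section KeplerEquation

variable {ζ R : ℝ} {y : QPhase}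

/-- The function whose zero is the solution of Kepler's equation on the orbit of `y`. -/
def keplerFn (ζ R : ℝ) (y : QPhase) (t : ℝ) : ℝ :=
  t - sn ζ t * (y.1.2 / R) + cs ζ t * (y.2.2 / covNorm ζ y)

/-- In this form a root t yields a point z = rot_t y whose own shift angle is -t, so the shift
carries z back to y. -/
theorem keplerFn_eq (hR : R ≠ 0) (hw : covNorm ζ y ≠ 0) (t : ℝ) :
    keplerFn ζ R y t = t + (rot ζ (R / covNorm ζ y) t y).2.2 / covNorm ζ y := by
  simp only [keplerFn, rot, Prod.snd_add, Prod.smul_snd, smul_eq_mul]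
  field_simp
  ring

theorem hasDerivAt_keplerFn (hζ : ζ = 1 ∨ ζ = -1) (hR : R ≠ 0) (hw : covNorm ζ y ≠ 0) (t : ℝ) :
    HasDerivAt (keplerFn ζ R y) (1 - (rot ζ (R / covNorm ζ y) t y).1.2 / R) t := by
  have h := ((hasDerivAt_id t).sub ((hasDerivAt_sn hζ t).mul_const (y.1.2 / R))).add
    ((hasDerivAt_cs hζ t).mul_const (y.2.2 / covNorm ζ y))
  refine h.congr_deriv ?_
  simp only [rot, Prod.snd_add, Prod.smul_snd, smul_eq_mul]
  field_simp
  ring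

/-- The derivative is 1 - h/R at the rotated point: heights are at most R on the sphere and at least
R on the hyperboloid. -/
theorem monotone_keplerFn (hζ : ζ = 1 ∨ ζ = -1) (hR : 0 < R) (hy : y ∈ cotangent₀ ζ R) :
    Monotone fun t => ζ * keplerFn ζ R y t := by
  have hd := fun t => (hasDerivAt_keplerFn hζ hR.ne' (covNorm_pos hζ hR hy).ne' t).const_mul ζ
  refine monotone_of_deriv_nonneg (fun t => (hd t).differentiableAt) fun t => ?_
  rw [(hd t).deriv]
  have h := sign_mul_height_le hζ hR (rot_mem hζ hR hy t).1.1
  have e : ζ * (1 - (rot ζ (R / covNorm ζ y) t y).1.2 / R) =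
      (ζ * (R - (rot ζ (R / covNorm ζ y) t y).1.2)) / R := by field_simp
  rw [e]
  exact div_nonneg h hR.le

/-- Two equal values force the monotone function to be constant on an interval. There the height is
R, hence its derivative, proportional to W_h, is 0. The derivative of W_h, proportional to the
height R, would then vanish too, which is absurd. -/
theorem keplerFn_injective (hζ : ζ = 1 ∨ ζ = -1) (hR : 0 < R) (hy : y ∈ cotangent₀ ζ R) :
    Function.Injective (keplerFn ζ R y) := by
  have hw := covNorm_pos hζ hR hy
  have hc : R / covNorm ζ y ≠ 0 := (div_pos hR hw).ne'
  have main : ∀ a b : ℝ, a < b → keplerFn ζ R y a ≠ keplerFn ζ R y b := by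
    intro a b hab h
    have hmono := monotone_keplerFn hζ hR hy
    have hconst : ∀ t ∈ Set.Ioo a b, keplerFn ζ R y t = keplerFn ζ R y a := fun t ht => by
      have h1 := hmono ht.1.le
      have h2 := hmono ht.2.le
      simp only [← h] at h1 h2
      exact mul_left_cancel₀ (ne_zero_of_sign hζ) (le_antisymm h2 h1)
    have hheight : ∀ t ∈ Set.Ioo a b, (rot ζ (R / covNorm ζ y) t y).1.2 = R := fun t ht => by
      have hd := hasDerivAt_keplerFn hζ hR.ne' hw.ne' t
      have hd0 : HasDerivAt (keplerFn ζ R y) 0 t :=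
        (hasDerivAt_const t (keplerFn ζ R y a)).congr_of_eventuallyEq
          (Filter.eventually_of_mem (Ioo_mem_nhds ht.1 ht.2) hconst)
      have := hd.unique hd0
      field_simp at this
      linarith
    have hslope : ∀ t ∈ Set.Ioo a b, (rot ζ (R / covNorm ζ y) t y).2.2 = 0 := fun t ht => by
      have hd := hasDerivAt_snd_comp (hasDerivAt_fst_comp (hasDerivAt_rot hζ hc t y))
      have hd0 : HasDerivAt (fun t => (rot ζ (R / covNorm ζ y) t y).1.2) 0 t :=
        (hasDerivAt_const t R).congr_of_eventuallyEq
          (Filter.eventually_of_mem (Ioo_mem_nhds ht.1 ht.2) hheight)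
      have := hd.unique hd0
      simpa [ne_zero_of_sign hζ, hR.ne', hw.ne'] using this
    obtain ⟨t, ht⟩ := Set.nonempty_Ioo.2 hab
    have hd := hasDerivAt_snd_comp (hasDerivAt_snd_comp (hasDerivAt_rot hζ hc t y))
    have hd0 : HasDerivAt (fun t => (rot ζ (R / covNorm ζ y) t y).2.2) 0 t :=
      (hasDerivAt_const t (0 : ℝ)).congr_of_eventuallyEq
        (Filter.eventually_of_mem (Ioo_mem_nhds ht.1 ht.2) hslope)
    have := hd.unique hd0
    simp [hR.ne', hw.ne', hheight t ht] at this
  intro a b h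
  rcases lt_trichotomy a b with hab | hab | hab
  · exact absurd h (main a b hab)
  · exact hab
  · exact absurd h.symm (main b a hab)

/-- The coefficient of exp t is -(α - β)/2 < 0, so the exponential beats the linear term for large
t. -/
theorem exists_sub_sinh_add_cosh_nonpos {α β : ℝ} (h : |β| < α) :
    ∃ t : ℝ, t - Real.sinh t * α + Real.cosh t * β ≤ 0 := by
  obtain ⟨h1, h2⟩ := abs_lt.1 h
  have hδ : 0 < α - β := by linarith
  have hs : 0 < α + β := by linarith
  -- With exp T ≥ T²/2, this T makes (α - β) exp T / 2 at least T(1 + (α + β)/2), while T ≥ 1 and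
  -- exp(-T) ≤ 1 bound the other terms by that amount.
  set T : ℝ := 4 * (1 + (α + β) / 2) / (α - β) + 1 with hT
  have hT1 : 1 ≤ T := by
    have : 0 ≤ 4 * (1 + (α + β) / 2) / (α - β) := by positivity
    linarith
  have hexp : T ^ 2 / 2 ≤ Real.exp T := by
    have := Real.quadratic_le_exp_of_nonneg (x := T) (by linarith)
    linarith
  have hexp' : Real.exp (-T) ≤ 1 := Real.exp_le_one_iff.2 (by linarith)
  have hprod : 4 * (1 + (α + β) / 2) ≤ T * (α - β) := by
    rw [hT, add_mul, div_mul_cancel₀ _ hδ.ne']; linarith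
  refine ⟨T, ?_⟩
  rw [Real.sinh_eq, Real.cosh_eq]
  have e1 : (α - β) * (T ^ 2 / 2) ≤ (α - β) * Real.exp T := mul_le_mul_of_nonneg_left hexp hδ.le
  have e2 : (α + β) * Real.exp (-T) ≤ (α + β) * 1 := mul_le_mul_of_nonneg_left hexp' hs.le
  have e3 : T * (4 * (1 + (α + β) / 2)) ≤ T * (T * (α - β)) :=
    mul_le_mul_of_nonneg_left hprod (by linarith)
  have e4 : 0 ≤ (T - 1) * (α + β) := mul_nonneg (by linarith) hs.le
  linarith

/-- By the intermediate value theorem. On the sphere the trigonometric terms are bounded, so t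
dominates; on the hyperboloid the exponentials dominate. -/
theorem exists_keplerFn_eq_zero (hζ : ζ = 1 ∨ ζ = -1) (hR : 0 < R) (hy : y ∈ cotangent₀ ζ R) :
    ∃ t, keplerFn ζ R y t = 0 := by
  have hcont : Continuous (keplerFn ζ R y) := continuous_iff_continuousAt.2 fun t =>
    (hasDerivAt_keplerFn hζ hR.ne' (covNorm_pos hζ hR hy).ne' t).continuousAt
  suffices h : (∃ t, keplerFn ζ R y t ≤ 0) ∧ ∃ t, 0 ≤ keplerFn ζ R y t from
    mem_range_of_exists_le_of_exists_ge hcont h.1 h.2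
  rcases hζ with rfl | rfl
  · set α := y.1.2 / R with hα
    set β := y.2.2 / covNorm 1 y with hβ
    have bound : ∀ t : ℝ, |-(Real.sin t * α) + Real.cos t * β| ≤ |α| + |β| := fun t => by
      refine (abs_add_le _ _).trans ?_
      rw [abs_neg, abs_mul, abs_mul]
      have h1 := mul_le_mul_of_nonneg_right (Real.abs_sin_le_one t) (abs_nonneg α)
      have h2 := mul_le_mul_of_nonneg_right (Real.abs_cos_le_one t) (abs_nonneg β)
      linarith
    have e : ∀ t, keplerFn 1 R y t = t + (-(Real.sin t * α) + Real.cos t * β) := fun t => by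
      simp only [keplerFn, sn, cs, if_true]; ring
    refine ⟨⟨-(|α| + |β|), ?_⟩, ⟨|α| + |β|, ?_⟩⟩
    · rw [e]; linarith [abs_le.1 (bound (-(|α| + |β|)))]
    · rw [e]; linarith [abs_le.1 (bound (|α| + |β|))]
  · have h := abs_cov_height_lt hR hy
    set α := y.1.2 / R with hα
    set β := y.2.2 / covNorm (-1) y with hβ
    have e : ∀ t, keplerFn (-1) R y t = t - Real.sinh t * α + Real.cosh t * β := fun t => by
      norm_num [keplerFn, sn, cs, hα, hβ]
    refine ⟨?_, ?_⟩
    · obtain ⟨t, ht⟩ := exists_sub_sinh_add_cosh_nonpos h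
      exact ⟨t, by rw [e]; exact ht⟩
    -- Replacing (t, β) by (-t, -β) changes the sign of the function.
    · obtain ⟨t, ht⟩ := exists_sub_sinh_add_cosh_nonpos (β := -β) (by rwa [abs_neg])
      refine ⟨-t, ?_⟩
      rw [e, Real.sinh_neg, Real.cosh_neg]
      linarith

/-- The solution of Kepler's equation on the orbit of `y`. -/
def keplerRoot (ζ R : ℝ) (y : QPhase) : ℝ := Classical.epsilon fun t => keplerFn ζ R y t = 0

theorem keplerFn_keplerRoot (hζ : ζ = 1 ∨ ζ = -1) (hR : 0 < R) (hy : y ∈ cotangent₀ ζ R) :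
    keplerFn ζ R y (keplerRoot ζ R y) = 0 :=
  Classical.epsilon_spec (exists_keplerFn_eq_zero hζ hR hy)

theorem keplerRoot_eq (hζ : ζ = 1 ∨ ζ = -1) (hR : 0 < R) (hy : y ∈ cotangent₀ ζ R) {t : ℝ}
    (h : keplerFn ζ R y t = 0) : keplerRoot ζ R y = t :=
  keplerFn_injective hζ hR hy ((keplerFn_keplerRoot hζ hR hy).trans h.symm)

/-- The point of the orbit of `y` at the solution of Kepler's equation. -/
def unshift (ζ R : ℝ) (y : QPhase) : QPhase := rot ζ (R / covNorm ζ y) (keplerRoot ζ R y) y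

/-- The rotation of `y` by the angle `W_h / ‖W‖`. -/
def shift (ζ R : ℝ) (y : QPhase) : QPhase :=
  rot ζ (R / covNorm ζ y) (y.2.2 / covNorm ζ y) y

theorem unshift_height (hζ : ζ = 1 ∨ ζ = -1) (hR : 0 < R) (hy : y ∈ cotangent₀ ζ R) :
    (unshift ζ R y).2.2 / covNorm ζ y = -keplerRoot ζ R y := by
  have h := keplerFn_keplerRoot hζ hR hy
  rw [keplerFn_eq hR.ne' (covNorm_pos hζ hR hy).ne'] at h
  rw [unshift]; linarith

theorem slope_eq_zero_of_height (hζ : ζ = 1 ∨ ζ = -1) (hR : 0 < R) (hy : y ∈ cotangent ζ R)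
    (h : y.1 = north R) : y.2.2 = 0 := by
  have := hy.2
  rw [h] at this
  simpa [form, north, ne_zero_of_sign hζ, hR.ne'] using this

/-- Covectors at the north pole have W_h = 0. An unshifted point lying over N therefore has shift
angle 0, so the root was 0 and y itself lay over N. -/
theorem unshift_mem (hζ : ζ = 1 ∨ ζ = -1) (hR : 0 < R) (hy : y ∈ cotangentPunctured₀ ζ R) :
    unshift ζ R y ∈ cotangentPunctured₀ ζ R := by
  have hmem : unshift ζ R y ∈ cotangent₀ ζ R := rot_mem hζ hR hy.1 _
  refine ⟨hmem, fun hn => hy.2 ?_⟩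
  have h0 := slope_eq_zero_of_height hζ hR hmem.1 hn
  have h := unshift_height hζ hR hy.1
  have hroot : keplerRoot ζ R y = 0 := by simpa [h0] using h
  rw [unshift, hroot, rot_zero] at hn
  exact hn

theorem keplerRoot_shift (hζ : ζ = 1 ∨ ζ = -1) (hR : 0 < R) (hy : y ∈ cotangent₀ ζ R) :
    keplerRoot ζ R (shift ζ R y) = -(y.2.2 / covNorm ζ y) := by
  have hw := covNorm_pos hζ hR hy
  have hc : R / covNorm ζ y ≠ 0 := (div_pos hR hw).ne'
  refine keplerRoot_eq hζ hR (rot_mem hζ hR hy _) ?_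
  change keplerFn ζ R (shift ζ R y) _ = 0
  have e : covNorm ζ (shift ζ R y) = covNorm ζ y := covNorm_rot hζ hR hy _
  rw [keplerFn_eq hR.ne' (by rw [e]; exact hw.ne'), e, shift, rot_rot hζ hc, neg_add_cancel,
    rot_zero, neg_add_cancel]

theorem unshift_shift (hζ : ζ = 1 ∨ ζ = -1) (hR : 0 < R) (hy : y ∈ cotangent₀ ζ R) :
    unshift ζ R (shift ζ R y) = y := by
  have hc : R / covNorm ζ y ≠ 0 := (div_pos hR (covNorm_pos hζ hR hy)).ne'
  have e : covNorm ζ (shift ζ R y) = covNorm ζ y := covNorm_rot hζ hR hy _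
  rw [unshift, keplerRoot_shift hζ hR hy, e, shift, rot_rot hζ hc, neg_add_cancel, rot_zero]

theorem shift_unshift (hζ : ζ = 1 ∨ ζ = -1) (hR : 0 < R) (hy : y ∈ cotangent₀ ζ R) :
    shift ζ R (unshift ζ R y) = y := by
  have hc : R / covNorm ζ y ≠ 0 := (div_pos hR (covNorm_pos hζ hR hy)).ne'
  have e : covNorm ζ (unshift ζ R y) = covNorm ζ y := covNorm_rot hζ hR hy _
  rw [shift, e, unshift_height hζ hR hy, unshift, rot_rot hζ hc, neg_add_cancel, rot_zero]

/-- Over N the root of Kepler's equation is 0. For a shifted point that root is minus the shift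
angle, so nothing was rotated and y already lay over N. -/
theorem shift_mem (hζ : ζ = 1 ∨ ζ = -1) (hR : 0 < R) (hy : y ∈ cotangentPunctured₀ ζ R) :
    shift ζ R y ∈ cotangentPunctured₀ ζ R := by
  have hmem : shift ζ R y ∈ cotangent₀ ζ R := rot_mem hζ hR hy.1 _
  refine ⟨hmem, fun hn => hy.2 ?_⟩
  have h0 := slope_eq_zero_of_height hζ hR hmem.1 hn
  have hroot : keplerRoot ζ R (shift ζ R y) = 0 := keplerRoot_eq hζ hR hmem (by
    simp [keplerFn, sn_zero, h0])
  rw [keplerRoot_shift hζ hR hy.1, neg_eq_zero] at hroot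
  rw [shift, hroot, rot_zero] at hn
  exact hn

/-! ### Smoothness of the shift and of its inverse -/

theorem contDiffAt_shift (hζ : ζ = 1 ∨ ζ = -1) (hR : 0 < R) (hy : y ∈ cotangent₀ ζ R) :
    ContDiffAt ℝ ω (shift ζ R) y := by
  have h := (form_cov_pos hζ hR hy).ne'
  have hw := (covNorm_pos hζ hR hy).ne'
  have hN := contDiffAt_covNorm h
  have hc : ContDiffAt ℝ ω (fun z : QPhase => R / covNorm ζ z) y := contDiffAt_const.div hN hw
  have ht : ContDiffAt ℝ ω (fun z : QPhase => z.2.2 / covNorm ζ z) y :=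
    ContDiffAt.div (by fun_prop) hN hw
  exact contDiffAt_rot hc ht contDiffAt_id (div_ne_zero hR.ne' hw)

theorem contDiffAt_keplerFn (h : 0 < form ζ y.2 y.2) (t : ℝ) :
    ContDiffAt ℝ ω (fun z : QPhase × ℝ => keplerFn ζ R z.1 z.2) (y, t) := by
  have hN : ContDiffAt ℝ ω (fun z : QPhase × ℝ => covNorm ζ z.1) (y, t) :=
    ContDiffAt.comp (y, t) (g := covNorm ζ) (contDiffAt_covNorm h.ne') contDiffAt_fst
  have hw : covNorm ζ y ≠ 0 := (Real.sqrt_pos.2 h).ne'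
  have h1 : ContDiffAt ℝ ω (fun z : QPhase × ℝ => z.1.1.2) (y, t) := by fun_prop
  have h2 : ContDiffAt ℝ ω (fun z : QPhase × ℝ => z.1.2.2) (y, t) := by fun_prop
  have hcs : ContDiffAt ℝ ω (fun z : QPhase × ℝ => cs ζ z.2) (y, t) :=
    (contDiff_cs ζ).contDiffAt.comp (y, t) contDiffAt_snd
  have hsn : ContDiffAt ℝ ω (fun z : QPhase × ℝ => sn ζ z.2) (y, t) :=
    (contDiff_sn ζ).contDiffAt.comp (y, t) contDiffAt_snd
  exact (contDiffAt_snd.sub (hsn.mul (h1.div_const R))).add (hcs.mul (h2.div hN hw))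

theorem isInvertible_of_apply_one {L : ℝ →L[ℝ] ℝ} (h : L 1 ≠ 0) : L.IsInvertible := by
  refine ⟨ContinuousLinearEquiv.unitsEquivAut ℝ (Units.mk0 (L 1) h), ?_⟩
  ext
  simp

/-- Implicit function theorem: the partial derivative 1 - h/R at the root is nonzero because the
unshifted point does not lie over N. -/
theorem smoothOn_keplerRoot (hζ : ζ = 1 ∨ ζ = -1) (hR : 0 < R) :
    SmoothOn (keplerRoot ζ R) (cotangentPunctured₀ ζ R) := by
  intro y hy
  have hpos := form_cov_pos hζ hR hy.1
  have hw := covNorm_pos hζ hR hy.1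
  set t₀ := keplerRoot ζ R y with ht₀
  have cdf := contDiffAt_keplerFn (R := R) hpos t₀
  have hne : 1 - (rot ζ (R / covNorm ζ y) t₀ y).1.2 / R ≠ 0 := by
    intro h0
    have hmem := unshift_mem hζ hR hy
    refine hmem.2 ((height_eq_iff hζ hmem.1.1.1).1 ?_)
    rw [unshift, ← ht₀]
    field_simp at h0
    linarith
  have hinv : (fderiv ℝ (fun z : QPhase × ℝ => keplerFn ζ R z.1 z.2) (y, t₀) ∘L
      .inr ℝ QPhase ℝ).IsInvertible := by
    refine isInvertible_of_apply_one ?_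
    have h1 : HasDerivAt (fun t : ℝ => ((y, t) : QPhase × ℝ)) (0, 1) t₀ :=
      (hasDerivAt_const t₀ y).prodMk (hasDerivAt_id t₀)
    have h2 := (cdf.differentiableAt (by simp)).hasFDerivAt.comp_hasDerivAt t₀ h1
    have h3 := h2.unique (hasDerivAt_keplerFn hζ hR.ne' hw.ne' t₀)
    simpa [h3] using hne
  have hn : (ω : WithTop ℕ∞) ≠ 0 := by simp
  have hroot := cdf.eventually_apply_implicitFunction hn hinv
  have hcd := cdf.contDiffAt_implicitFunction hn hinv
  obtain ⟨U, hU, hyU, hψ⟩ := exists_contDiffOn_of_contDiffAt hcd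
  obtain ⟨U', hU'sub, hU', hyU'⟩ := mem_nhds_iff.1 hroot
  refine ⟨U ∩ U', hU.inter hU', ⟨hyU, hyU'⟩, _, hψ.mono Set.inter_subset_left, ?_⟩
  rintro z ⟨hz, -, hzU'⟩
  -- The implicit function lives on an open set of the ambient space; on the cotangent bundle,
  -- uniqueness of the root identifies it with `keplerRoot`.
  refine keplerRoot_eq hζ hR hz.1 ((hU'sub hzU').trans ?_)
  exact keplerFn_keplerRoot hζ hR hy.1

theorem smoothOn_unshift (hζ : ζ = 1 ∨ ζ = -1) (hR : 0 < R) :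
    SmoothOn (unshift ζ R) (cotangentPunctured₀ ζ R) := by
  intro y hy
  obtain ⟨U, hU, hyU, ψ, hψ, he⟩ := smoothOn_keplerRoot hζ hR y hy
  have hpos : IsOpen {z : QPhase | 0 < form ζ z.2 z.2} :=
    isOpen_lt continuous_const (continuous_iff_continuousAt.2 fun z =>
      (contDiffAt_form_cov (ζ := ζ) (y := z)).continuousAt)
  refine ⟨U ∩ {z | 0 < form ζ z.2 z.2}, hU.inter hpos, ⟨hyU, form_cov_pos hζ hR hy.1⟩,
    fun z => rot ζ (R / covNorm ζ z) (ψ z) z, ?_, ?_⟩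
  · rintro z ⟨hzU, hz⟩
    have hw : covNorm ζ z ≠ 0 := (Real.sqrt_pos.2 hz).ne'
    have hc : ContDiffAt ℝ ∞ (fun z : QPhase => R / covNorm ζ z) z :=
      contDiffAt_const.div ((contDiffAt_covNorm hz.ne').of_le le_top) hw
    have ht : ContDiffAt ℝ ∞ ψ z := hψ.contDiffAt (hU.mem_nhds hzU)
    exact (contDiffAt_rot hc ht contDiffAt_id (div_ne_zero hR.ne' hw)).contDiffWithinAt
  · rintro z ⟨hz, hzU, -⟩
    simp only [unshift, he ⟨hz, hzU⟩]

end KeplerEquation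

/-! ### The map `S⁻¹` on the phase space -/

section StereographicLift

variable {ζ m k R : ℝ} {x : KPhase} {y : QPhase}

theorem energyRadius_pos (hm : 0 < m) (hx : x ∈ keplerPhase ζ m k) : 0 < energyRadius ζ m k x := by
  refine Real.sqrt_pos.2 ?_
  have := hx.2
  nlinarith

theorem energyRadius_sq (hm : 0 < m) (hx : x ∈ keplerPhase ζ m k) :
    energyRadius ζ m k x ^ 2 = -(2 * m * ζ * energy m k x) := by
  refine Real.sq_sqrt ?_
  have := hx.2
  nlinarith

theorem energy_eq (hζ : ζ = 1 ∨ ζ = -1) (hm : 0 < m) (hx : x ∈ keplerPhase ζ m k) :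
    energy m k x = -(ζ * energyRadius ζ m k x ^ 2) / (2 * m) := by
  rw [energyRadius_sq hm hx]
  field_simp
  linear_combination -energy m k x * sq_eq_one_of_sign hζ

/-- The energy relation r(p² + ζρ²) = 2K, used below to eliminate p². -/
theorem norm_mul_energy (hζ : ζ = 1 ∨ ζ = -1) (hm : 0 < m) (hx : x ∈ keplerPhase ζ m k) :
    ‖x.1‖ * (‖x.2‖ ^ 2 + ζ * energyRadius ζ m k x ^ 2) = 2 * (m ^ 2 * k) := by
  have hn : ‖x.1‖ ≠ 0 := norm_ne_zero_iff.2 hx.1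
  rw [energyRadius_sq hm hx, energy]
  field_simp
  linear_combination (‖x.2‖ ^ 2 * ‖x.1‖ * (-1) + 2 * m ^ 2 * k) * sq_eq_one_of_sign hζ

theorem isOpen_keplerPhase : IsOpen (keplerPhase ζ m k) := by
  refine isOpen_iff_mem_nhds.2 fun x hx => ?_
  have h1 : ∀ᶠ z : KPhase in 𝓝 x, z.1 ≠ 0 := continuousAt_fst.eventually_ne hx.1
  have h2 : ∀ᶠ z : KPhase in 𝓝 x, ζ * energy m k z < 0 :=
    ((contDiffAt_energy hx.1).continuousAt.const_mul ζ).eventually_lt continuousAt_const hx.2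
  filter_upwards [h1, h2] with z hz1 hz2 using ⟨hz1, hz2⟩

/-- An expression of `S⁻¹` where the energy relation has been used. -/
theorem SInv_eq (hζ : ζ = 1 ∨ ζ = -1) (hm : 0 < m) (hk : 0 < k) (hR : 0 < R)
    (hx : x ∈ keplerPhase ζ m k) :
    SInv ζ m k R x =
      (((ζ * R / (m ^ 2 * k) * (energyRadius ζ m k x * ‖x.1‖)) • x.2,
          R * (‖x.1‖ * ‖x.2‖ ^ 2 / (m ^ 2 * k) - 1)),
        ((ζ * (m ^ 2 * k) / R / (energyRadius ζ m k x * ‖x.1‖)) • x.1 -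
            (ζ / R * (inner ℝ x.1 x.2 / energyRadius ζ m k x)) • x.2,
          ζ / R * inner ℝ x.1 x.2)) := by
  have hrel := norm_mul_energy hζ hm hx
  have hρ := energyRadius_pos hm hx
  have hn : 0 < ‖x.1‖ := norm_pos_iff.2 hx.1
  have hz := sq_eq_one_of_sign hζ
  have hz0 := ne_zero_of_sign hζ
  simp only [SInv, cotangentLift, invStereo]
  generalize energyRadius ζ m k x = ρ at *
  generalize ‖x.1‖ = n at *
  have hK : 0 < m ^ 2 * k := by positivity
  generalize m ^ 2 * k = K at *
  have e1 : ‖x.2‖ ^ 2 + ζ * ρ ^ 2 = 2 * K / n := by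
    field_simp; linear_combination hrel
  have e2 : ρ ^ 2 + ζ * ‖x.2‖ ^ 2 = ζ * (2 * K / n) := by
    rw [← e1]; linear_combination -ρ ^ 2 * hz
  have e3 : ‖x.2‖ ^ 2 - ζ * ρ ^ 2 = 2 * ‖x.2‖ ^ 2 - 2 * K / n := by linarith
  rw [e1, e2, e3]
  refine Prod.ext (Prod.ext ?_ ?_) (Prod.ext ?_ ?_)
  · simp only
    congr 1
    field_simp
    linear_combination -hz
  · simp only
    field_simp
  · simp only
    congr 2 <;> field_simp
  · simp only
    ring

theorem covNorm_SInv (hζ : ζ = 1 ∨ ζ = -1) (hm : 0 < m) (hk : 0 < k) (hR : 0 < R)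
    (hx : x ∈ keplerPhase ζ m k) :
    covNorm ζ (SInv ζ m k R x) = m ^ 2 * k / (R * energyRadius ζ m k x) := by
  have hρ := energyRadius_pos hm hx
  rw [covNorm, Real.sqrt_eq_iff_mul_self_eq_of_pos (by positivity), SInv_eq hζ hm hk hR hx]
  have hrel := norm_mul_energy hζ hm hx
  have hn : 0 < ‖x.1‖ := norm_pos_iff.2 hx.1
  simp only [form, inner_sub_left, inner_sub_right, inner_smul_right, real_inner_smul_left,
    real_inner_self_eq_norm_sq, real_inner_comm x.1 x.2]
  generalize energyRadius ζ m k x = ρ at *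
  generalize ‖x.1‖ = n at *
  generalize m ^ 2 * k = K at *
  generalize inner ℝ x.1 x.2 = a at *
  have e1 : ‖x.2‖ ^ 2 = 2 * K / n - ζ * ρ ^ 2 := by
    field_simp; linear_combination hrel
  rw [e1]
  field_simp
  rcases hζ with rfl | rfl <;> ring

theorem SInv_mem (hζ : ζ = 1 ∨ ζ = -1) (hm : 0 < m) (hk : 0 < k) (hR : 0 < R)
    (hx : x ∈ keplerPhase ζ m k) : SInv ζ m k R x ∈ cotangentPunctured₀ ζ R := by
  have hρ := energyRadius_pos hm hx
  have hrel := norm_mul_energy hζ hm hx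
  have hn : 0 < ‖x.1‖ := norm_pos_iff.2 hx.1
  have hK : 0 < m ^ 2 * k := by positivity
  have hz0 := ne_zero_of_sign hζ
  have hz := sq_eq_one_of_sign hζ
  -- The denominator of the stereographic formula is ζ · 2K/r by the energy relation.
  have hD : energyRadius ζ m k x ^ 2 + ζ * ‖x.2‖ ^ 2 ≠ 0 := fun h => by
    have e : ‖x.2‖ ^ 2 + ζ * energyRadius ζ m k x ^ 2 = 0 := by
      linear_combination ζ * h - ‖x.2‖ ^ 2 * hz
    rw [e, mul_zero] at hrel
    linarith
  refine ⟨⟨⟨⟨invStereo_quadric hζ x.2 hD, ?_⟩,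
    cotangentLift_tangent hζ hR.ne' hρ.ne' x hD⟩, fun h => ?_⟩, fun h => ?_⟩
  · rintro rfl
    rw [SInv_eq hζ hm hk hR hx]
    simp only
    refine mul_pos hR ?_
    -- For ζ = -1 the energy relation gives r p² = 2K + rρ² > K, so h > 0.
    have : 0 < ‖x.1‖ * energyRadius (-1) m k x ^ 2 := by positivity
    rw [sub_pos, lt_div_iff₀ hK]
    linarith
  · have h1 := covNorm_SInv hζ hm hk hR hx
    rw [covNorm, h, form_zero_left, Real.sqrt_zero] at h1
    have : 0 < m ^ 2 * k / (R * energyRadius ζ m k x) := by positivity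
    linarith
  · rw [SInv_eq hζ hm hk hR hx] at h
    have h2 : R * (‖x.1‖ * ‖x.2‖ ^ 2 / (m ^ 2 * k) - 1) = R := congrArg Prod.snd h
    field_simp at h2
    have h3 : ζ * (‖x.1‖ * energyRadius ζ m k x ^ 2) = 0 := by linarith
    have : 0 < ‖x.1‖ * energyRadius ζ m k x ^ 2 := by positivity
    exact mul_ne_zero hz0 this.ne' h3

theorem HQ_SInv (hζ : ζ = 1 ∨ ζ = -1) (hm : 0 < m) (hk : 0 < k) (hR : 0 < R)
    (hx : x ∈ keplerPhase ζ m k) : HQ ζ m k R (SInv ζ m k R x) = energy m k x := by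
  rw [HQ, covNorm_sq hζ hR (SInv_mem hζ hm hk hR hx).1, covNorm_SInv hζ hm hk hR hx,
    energy_eq hζ hm hx]
  field_simp

/-- The inverse of `S⁻¹`. -/
def SMap (ζ m k R : ℝ) (y : QPhase) : KPhase :=
  ((R * covNorm ζ y / (m ^ 2 * k)) • ((R - y.1.2) • y.2.1 + y.2.2 • y.1.1),
    (m ^ 2 * k / (R * covNorm ζ y) / (R - y.1.2)) • y.1.1)

theorem contDiffAt_SMap (hR : 0 < R) (h : 0 < form ζ y.2 y.2) (hy : R - y.1.2 ≠ 0) :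
    ContDiffAt ℝ ω (SMap ζ m k R) y := by
  have hw : covNorm ζ y ≠ 0 := (Real.sqrt_pos.2 h).ne'
  have hN := contDiffAt_covNorm h.ne'
  have h1 : ContDiffAt ℝ ω (fun y : QPhase => R - y.1.2) y := by fun_prop
  have h2 : ContDiffAt ℝ ω (fun y : QPhase => (R - y.1.2) • y.2.1 + y.2.2 • y.1.1) y := by fun_prop
  have h3 : ContDiffAt ℝ ω (fun y : QPhase => y.1.1) y := by fun_prop
  exact (((contDiffAt_const.mul hN).div_const _).smul h2).prodMk
    (((contDiffAt_const.div (contDiffAt_const.mul hN) (mul_ne_zero hR.ne' hw)).div h1 hy).smul h3)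

theorem sub_height_ne_zero (hζ : ζ = 1 ∨ ζ = -1) (hy : y ∈ cotangentPunctured₀ ζ R) :
    R - y.1.2 ≠ 0 := fun h =>
  hy.2 ((height_eq_iff hζ hy.1.1.1).1 (by linarith))

theorem SMap_SInv (hζ : ζ = 1 ∨ ζ = -1) (hm : 0 < m) (hk : 0 < k) (hR : 0 < R)
    (hx : x ∈ keplerPhase ζ m k) : SMap ζ m k R (SInv ζ m k R x) = x := by
  have hρ := energyRadius_pos hm hx
  have hrel := norm_mul_energy hζ hm hx
  have hn : 0 < ‖x.1‖ := norm_pos_iff.2 hx.1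
  have hK : 0 < m ^ 2 * k := by positivity
  have hz0 := ne_zero_of_sign hζ
  have hz := sq_eq_one_of_sign hζ
  rw [SMap, covNorm_SInv hζ hm hk hR hx, SInv_eq hζ hm hk hR hx]
  simp only
  generalize energyRadius ζ m k x = ρ at *
  generalize m ^ 2 * k = K at *
  have e : R - R * (‖x.1‖ * ‖x.2‖ ^ 2 / K - 1) = ζ * R * ρ ^ 2 * ‖x.1‖ / K := by
    field_simp; linear_combination -hrel
  rw [e]
  refine Prod.ext ?_ ?_
  · simp only
    generalize inner ℝ x.1 x.2 = a at *
    have : (1 : ℝ) • x.1 = x.1 := one_smul _ _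
    conv_rhs => rw [← this]
    match_scalars
    · field_simp
      linear_combination hz
    · field_simp
      ring
  · simp only [smul_smul]
    conv_rhs => rw [← one_smul ℝ x.2]
    congr 1
    field_simp

/-- The norms of the components of `SMap` and their scalar product. -/
theorem SMap_norms (hζ : ζ = 1 ∨ ζ = -1) (hm : 0 < m) (hk : 0 < k) (hR : 0 < R)
    (hy : y ∈ cotangentPunctured₀ ζ R) :
    ‖(SMap ζ m k R y).1‖ = ζ * (R - y.1.2) * R * covNorm ζ y ^ 2 / (m ^ 2 * k) ∧
    ‖(SMap ζ m k R y).2‖ ^ 2 =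
      ζ * (m ^ 2 * k / (R * covNorm ζ y)) ^ 2 * (R + y.1.2) / (R - y.1.2) ∧
    inner ℝ (SMap ζ m k R y).1 (SMap ζ m k R y).2 = ζ * R * y.2.2 := by
  have hw := covNorm_pos hζ hR hy.1
  have hww := covNorm_sq hζ hR hy.1
  have hMW := hy.1.1.2
  have hM := hy.1.1.1.1
  have hh := sub_height_ne_zero hζ hy
  have hsign := sign_mul_height_le hζ hR hy.1.1.1
  have hz := sq_eq_one_of_sign hζ
  have hK : 0 < m ^ 2 * k := by positivity
  simp only [form, real_inner_self_eq_norm_sq] at hww hMW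
  simp only [SMap]
  generalize covNorm ζ y = w at *
  generalize m ^ 2 * k = K at *
  have hμ : ‖y.1.1‖ ^ 2 = ζ * (R ^ 2 - y.1.2 ^ 2) := by
    linear_combination ζ * hM - ‖y.1.1‖ ^ 2 * hz
  have hW : ‖y.2.1‖ ^ 2 = w ^ 2 - ζ * (y.2.2 * y.2.2) := by linarith
  have hi : inner ℝ y.1.1 y.2.1 = -(ζ * (y.1.2 * y.2.2)) := by linarith
  refine ⟨?_, ?_, ?_⟩
  -- The right side is nonnegative by `hsign`, so comparing squares is enough.
  · refine (sq_eq_sq₀ (norm_nonneg _) (by positivity)).1 ?_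
    rw [← real_inner_self_eq_norm_sq]
    simp only [inner_add_left, inner_add_right, inner_smul_right, real_inner_smul_left,
      real_inner_self_eq_norm_sq, real_inner_comm y.1.1 y.2.1, hi, hμ, hW]
    field_simp
    rcases hζ with rfl | rfl <;> ring
  · rw [norm_smul, mul_pow, hμ, Real.norm_eq_abs, sq_abs]
    field_simp
    ring
  · simp only [inner_add_left, inner_smul_right, real_inner_smul_left,
      real_inner_self_eq_norm_sq, real_inner_comm y.1.1 y.2.1, hi, hμ]
    field_simp
    ring

theorem energy_SMap (hζ : ζ = 1 ∨ ζ = -1) (hm : 0 < m) (hk : 0 < k) (hR : 0 < R)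
    (hy : y ∈ cotangentPunctured₀ ζ R) :
    energy m k (SMap ζ m k R y) = -(ζ * (m ^ 2 * k / (R * covNorm ζ y)) ^ 2) / (2 * m) := by
  obtain ⟨h1, h2, -⟩ := SMap_norms hζ hm hk hR hy
  have hh := sub_height_ne_zero hζ hy
  rw [energy, h1, h2]
  field_simp
  rcases hζ with rfl | rfl <;> ring

theorem SMap_mem (hζ : ζ = 1 ∨ ζ = -1) (hm : 0 < m) (hk : 0 < k) (hR : 0 < R)
    (hy : y ∈ cotangentPunctured₀ ζ R) : SMap ζ m k R y ∈ keplerPhase ζ m k := by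
  obtain ⟨h1, -, -⟩ := SMap_norms hζ hm hk hR hy
  have hw := covNorm_pos hζ hR hy.1
  have hh := sub_height_ne_zero hζ hy
  have hz0 := ne_zero_of_sign hζ
  have hz := sq_eq_one_of_sign hζ
  refine ⟨norm_ne_zero_iff.1 ?_, ?_⟩
  · rw [h1]; positivity
  · rw [energy_SMap hζ hm hk hR hy]
    have e : ζ * (-(ζ * (m ^ 2 * k / (R * covNorm ζ y)) ^ 2) / (2 * m)) =
        -((m ^ 2 * k / (R * covNorm ζ y)) ^ 2 / (2 * m)) := by
      linear_combination -((m ^ 2 * k / (R * covNorm ζ y)) ^ 2 / (2 * m)) * hz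
    rw [e, neg_lt_zero]
    positivity

theorem energyRadius_SMap (hζ : ζ = 1 ∨ ζ = -1) (hm : 0 < m) (hk : 0 < k) (hR : 0 < R)
    (hy : y ∈ cotangentPunctured₀ ζ R) :
    energyRadius ζ m k (SMap ζ m k R y) = m ^ 2 * k / (R * covNorm ζ y) := by
  have hw := covNorm_pos hζ hR hy.1
  have hz := sq_eq_one_of_sign hζ
  rw [energyRadius, energy_SMap hζ hm hk hR hy]
  have hρ : 0 < m ^ 2 * k / (R * covNorm ζ y) := by positivity
  generalize m ^ 2 * k / (R * covNorm ζ y) = ρ at *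
  have e : -(2 * m * ζ * (-(ζ * ρ ^ 2) / (2 * m))) = ρ ^ 2 := by
    field_simp
    linear_combination hz
  rw [e, Real.sqrt_sq hρ.le]

theorem SInv_SMap (hζ : ζ = 1 ∨ ζ = -1) (hm : 0 < m) (hk : 0 < k) (hR : 0 < R)
    (hy : y ∈ cotangentPunctured₀ ζ R) : SInv ζ m k R (SMap ζ m k R y) = y := by
  obtain ⟨h1, h2, h3⟩ := SMap_norms hζ hm hk hR hy
  have hw := covNorm_pos hζ hR hy.1
  have hh := sub_height_ne_zero hζ hy
  have hz0 := ne_zero_of_sign hζ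
  have hz := sq_eq_one_of_sign hζ
  rw [SInv_eq hζ hm hk hR (SMap_mem hζ hm hk hR hy), h1, h2, h3, energyRadius_SMap hζ hm hk hR hy]
  simp only [SMap]
  have hK : 0 < m ^ 2 * k := by positivity
  generalize m ^ 2 * k = K at *
  generalize covNorm ζ y = w at *
  refine Prod.ext (Prod.ext ?_ ?_) (Prod.ext ?_ ?_)
  · simp only [smul_smul]
    conv_rhs => rw [← one_smul ℝ y.1.1]
    congr 1
    field_simp
    linear_combination hz
  · simp only
    field_simp
    rcases hζ with rfl | rfl <;> ring
  · simp only
    conv_rhs => rw [← one_smul ℝ y.2.1]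
    match_scalars
    · field_simp
    · field_simp
      linear_combination -y.2.2 * hz
  · simp only
    field_simp
    linear_combination y.2.2 * hz

theorem contDiffAt_energyRadius (hm : 0 < m) (hx : x ∈ keplerPhase ζ m k) :
    ContDiffAt ℝ ω (energyRadius ζ m k) x := by
  unfold energyRadius
  refine ContDiffAt.sqrt (contDiffAt_const.mul (contDiffAt_energy hx.1)).neg ?_
  rw [← energyRadius_sq hm hx]
  exact (pow_pos (energyRadius_pos hm hx) 2).ne'

theorem contDiffAt_SInv (hζ : ζ = 1 ∨ ζ = -1) (hm : 0 < m) (hk : 0 < k) (hR : 0 < R)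
    (hx : x ∈ keplerPhase ζ m k) : ContDiffAt ℝ ω (SInv ζ m k R) x := by
  have hρ := (energyRadius_pos hm hx).ne'
  have hρ' := contDiffAt_energyRadius hm hx
  have hn := norm_ne_zero_iff.2 hx.1
  have hn' : ContDiffAt ℝ ω (fun x : KPhase => ‖x.1‖) x := contDiffAt_fst.norm ℝ hx.1
  have hP : ContDiffAt ℝ ω (fun x : KPhase => ‖x.2‖ ^ 2) x := contDiffAt_snd.norm_sq ℝ
  have ha : ContDiffAt ℝ ω (fun x : KPhase => (inner ℝ x.1 x.2 : ℝ)) x :=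
    contDiffAt_fst.inner ℝ contDiffAt_snd
  have hd := ((((contDiffAt_const (c := ζ * R / (m ^ 2 * k))).mul (hρ'.mul hn')).smul
    (contDiffAt_snd (E := E3) (F := E3))).prodMk
    ((contDiffAt_const (c := R)).mul (((hn'.mul hP).div_const (m ^ 2 * k)).sub
      (contDiffAt_const (c := (1 : ℝ)))))).prodMk
    (((((contDiffAt_const (c := ζ * (m ^ 2 * k) / R)).div (hρ'.mul hn')
      (mul_ne_zero hρ hn)).smul (contDiffAt_fst (E := E3) (F := E3))).sub
      (((contDiffAt_const (c := ζ / R)).mul (ha.div hρ' hρ)).smul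
        (contDiffAt_snd (E := E3) (F := E3)))).prodMk ((contDiffAt_const (c := ζ / R)).mul ha))
  refine hd.congr_of_eventuallyEq ?_
  filter_upwards [isOpen_keplerPhase.mem_nhds hx] with z hz using SInv_eq hζ hm hk hR hz

theorem isDiffeoOnto_SInv (hζ : ζ = 1 ∨ ζ = -1) (hm : 0 < m) (hk : 0 < k) (hR : 0 < R) :
    IsDiffeoOnto (SInv ζ m k R) (keplerPhase ζ m k) (cotangentPunctured₀ ζ R) :=
  isDiffeoOnto_of_invOn (smoothOn_of_contDiffAt fun _ hx => contDiffAt_SInv hζ hm hk hR hx)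
    (smoothOn_of_contDiffAt fun _ hy =>
      contDiffAt_SMap hR (form_cov_pos hζ hR hy.1) (sub_height_ne_zero hζ hy))
    (fun _ hx => SInv_mem hζ hm hk hR hx) (fun _ hy => SMap_mem hζ hm hk hR hy)
    ⟨fun _ hx => SMap_SInv hζ hm hk hR hx, fun _ hy => SInv_SMap hζ hm hk hR hy⟩

end StereographicLift

/-! ### Derivatives of `S⁻¹` -/

section Derivative

variable {ζ m k R : ℝ} {x : KPhase}

theorem hasDerivAt_energyRadius_line (hm : 0 < m) (hx : x ∈ keplerPhase ζ m k) (v : KPhase) :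
    HasDerivAt (fun t : ℝ => energyRadius ζ m k (x + t • v))
      (-(m * ζ * fderiv ℝ (energy m k) x v / energyRadius ζ m k x)) 0 := by
  have hE := hasDerivAt_comp_line ((contDiffAt_energy (m := m) (k := k) hx.1).differentiableAt
    (by simp)) v
  have hρ := energyRadius_pos hm hx
  have h := (hE.const_mul (2 * m * ζ)).fun_neg.sqrt (by
    rw [zero_smul, add_zero, ← energyRadius_sq hm hx]; exact (pow_pos hρ 2).ne')
  refine h.congr_deriv ?_
  have e : √(-(2 * m * ζ * energy m k (x + (0 : ℝ) • v))) = energyRadius ζ m k x := by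
    rw [zero_smul, add_zero]; rfl
  rw [e]
  field_simp

theorem hasDerivAt_inner_line (x v : KPhase) :
    HasDerivAt (fun t : ℝ => (inner ℝ (x + t • v).1 (x + t • v).2 : ℝ))
      (inner ℝ x.1 v.2 + inner ℝ v.1 x.2) 0 := by
  have h := hasDerivAt_line x v
  simpa using (hasDerivAt_fst_comp h).inner ℝ (hasDerivAt_snd_comp h)

theorem eventually_line_mem (hx : x ∈ keplerPhase ζ m k) (v : KPhase) :
    ∀ᶠ t : ℝ in 𝓝 0, x + t • v ∈ keplerPhase ζ m k := by
  have hc : ContinuousAt (fun t : ℝ => x + t • v) 0 := (hasDerivAt_line x v).continuousAt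
  exact hc.eventually_mem (by simpa using isOpen_keplerPhase.mem_nhds hx)

/-- The scalars and their derivatives enter as variables with defining equations only to keep the
formula legible; the applications fill them in by `rfl`. -/
theorem fderiv_SInv (hζ : ζ = 1 ∨ ζ = -1) (hm : 0 < m) (hk : 0 < k) (hR : 0 < R)
    (hx : x ∈ keplerPhase ζ m k) (v : KPhase) {n a ρ dn da dρ : ℝ} (hn : n = ‖x.1‖)
    (ha : a = inner ℝ x.1 x.2) (hρ : ρ = energyRadius ζ m k x) (hdn : dn = inner ℝ x.1 v.1 / n)
    (hda : da = inner ℝ x.1 v.2 + inner ℝ v.1 x.2)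
    (hdρ : dρ = -(m * ζ * fderiv ℝ (energy m k) x v / ρ)) :
    fderiv ℝ (SInv ζ m k R) x v =
      (((ζ * R / (m ^ 2 * k) * (dρ * n + ρ * dn)) • x.2 +
            (ζ * R / (m ^ 2 * k) * (ρ * n)) • v.2,
          R * ((dn * ‖x.2‖ ^ 2 + n * (2 * inner ℝ x.2 v.2)) / (m ^ 2 * k))),
        ((-(ζ * (m ^ 2 * k) / R * (dρ * n + ρ * dn) / (ρ * n) ^ 2)) • x.1 +
            (ζ * (m ^ 2 * k) / R / (ρ * n)) • v.1 -
            ((ζ / R * ((da * ρ - a * dρ) / ρ ^ 2)) • x.2 + (ζ / R * (a / ρ)) • v.2),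
          ζ / R * da)) := by
  refine fderiv_apply_eq ((contDiffAt_SInv hζ hm hk hR hx).differentiableAt (by simp)) ?_
  have hl := hasDerivAt_line x v
  have h1 := hasDerivAt_fst_comp hl
  have h2 := hasDerivAt_snd_comp hl
  have hn0 : n ≠ 0 := by rw [hn]; exact norm_ne_zero_iff.2 hx.1
  have hρ0 : ρ ≠ 0 := by rw [hρ]; exact (energyRadius_pos hm hx).ne'
  have hN : HasDerivAt (fun t : ℝ => ‖(x + t • v).1‖) dn 0 := by
    rw [hdn, hn]; exact hasDerivAt_norm_line hx.1 v.1
  have hP : HasDerivAt (fun t : ℝ => ‖(x + t • v).2‖ ^ 2) (2 * inner ℝ x.2 v.2) 0 :=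
    hasDerivAt_norm_sq_line x.2 v.2
  have hA : HasDerivAt (fun t : ℝ => (inner ℝ (x + t • v).1 (x + t • v).2 : ℝ)) da 0 := by
    rw [hda]; exact hasDerivAt_inner_line x v
  have hE : HasDerivAt (fun t : ℝ => energyRadius ζ m k (x + t • v)) dρ 0 := by
    rw [hdρ, hρ]; exact hasDerivAt_energyRadius_line hm hx v
  have e0 : x + (0 : ℝ) • v = x := by simp
  have hEN := hE.fun_mul hN
  have hd := ((((hEN.const_mul (ζ * R / (m ^ 2 * k))).fun_smul h2).prodMk
      ((((hN.fun_mul hP).div_const (m ^ 2 * k)).sub_const 1).const_mul R)).prodMk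
    (((((hasDerivAt_const (0 : ℝ) (ζ * (m ^ 2 * k) / R)).fun_div hEN
        (by rw [e0, ← hn, ← hρ]; exact mul_ne_zero hρ0 hn0)).fun_smul h1).fun_sub
      (((hA.fun_div hE (by rw [e0, ← hρ]; exact hρ0)).const_mul (ζ / R)).fun_smul h2)).prodMk
      (hA.const_mul (ζ / R))))
  refine (hd.congr_of_eventuallyEq ?_).congr_deriv ?_
  · filter_upwards [eventually_line_mem hx v] with t ht using SInv_eq hζ hm hk hR ht
  · simp only [e0, ← hn, ← hρ, ← ha]
    refine Prod.ext (Prod.ext ?_ ?_) (Prod.ext ?_ ?_)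
    · simp only; module
    · simp only
    · simp only; module
    · simp only

/-- `S⁻¹` sends the Liouville form `W · dM` to `r · dp - (r · p) dρ / ρ`. -/
theorem liouville_SInv (hζ : ζ = 1 ∨ ζ = -1) (hm : 0 < m) (hk : 0 < k) (hR : 0 < R)
    (hx : x ∈ keplerPhase ζ m k) (v : KPhase) :
    form ζ (SInv ζ m k R x).2 (fderiv ℝ (SInv ζ m k R) x v).1 =
      inner ℝ x.1 v.2 - inner ℝ x.1 x.2 / energyRadius ζ m k x *
        (-(m * ζ * fderiv ℝ (energy m k) x v / energyRadius ζ m k x)) := by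
  rw [fderiv_SInv hζ hm hk hR hx v rfl rfl rfl rfl rfl rfl, SInv_eq hζ hm hk hR hx,
    fderiv_energy hm.ne' hx.1]
  have hρ := energyRadius_pos hm hx
  have hrel := norm_mul_energy hζ hm hx
  have hn : 0 < ‖x.1‖ := norm_pos_iff.2 hx.1
  simp only [form, inner_add_right, inner_sub_left, inner_smul_right, real_inner_smul_left,
    real_inner_self_eq_norm_sq]
  generalize energyRadius ζ m k x = ρ at *
  generalize ‖x.1‖ = n at *
  generalize inner ℝ x.1 x.2 = a at *
  generalize inner ℝ x.1 v.2 = a₁ at *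
  generalize inner ℝ x.2 v.2 = a₂ at *
  generalize inner ℝ x.1 v.1 = a₃ at *
  have e1 : ‖x.2‖ ^ 2 = 2 * (m ^ 2 * k) / n - ζ * ρ ^ 2 := by
    field_simp; linear_combination hrel
  rw [e1]
  field_simp
  rcases hζ with rfl | rfl <;> ring

/-- `S⁻¹` sends the Kepler vector field to `g X_H`. -/
theorem fderiv_SInv_XE (hζ : ζ = 1 ∨ ζ = -1) (hm : 0 < m) (hk : 0 < k) (hR : 0 < R)
    (hx : x ∈ keplerPhase ζ m k) :
    fderiv ℝ (SInv ζ m k R) x (XE m k x) =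
      conformalFactor R (SInv ζ m k R x) • XH ζ m k R (SInv ζ m k R x) := by
  rw [XH_eq hζ hR (SInv_mem hζ hm hk hR hx).1, XHvec, freq, covNorm_SInv hζ hm hk hR hx,
    fderiv_SInv hζ hm hk hR hx _ rfl rfl rfl rfl rfl rfl, XE_eq hm.ne' hx.1,
    fderiv_energy hm.ne' hx.1, conformalFactor, SInv_eq hζ hm hk hR hx]
  have hρ := energyRadius_pos hm hx
  have hrel := norm_mul_energy hζ hm hx
  have hn : 0 < ‖x.1‖ := norm_pos_iff.2 hx.1
  simp only [inner_smul_right, real_inner_smul_left, real_inner_self_eq_norm_sq,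
    real_inner_comm x.1 x.2]
  generalize energyRadius ζ m k x = ρ at *
  generalize ‖x.1‖ = n at *
  generalize inner ℝ x.1 x.2 = a at *
  have e1 : ‖x.2‖ ^ 2 = 2 * (m ^ 2 * k) / n - ζ * ρ ^ 2 := by
    field_simp; linear_combination hrel
  rw [e1]
  have e2 : R * (n * (2 * (m ^ 2 * k) / n - ζ * ρ ^ 2) / (m ^ 2 * k) - 1) - R =
      -(ζ * R * ρ ^ 2 * n / (m ^ 2 * k)) := by
    field_simp; ring
  rw [e2]
  refine Prod.ext (Prod.ext ?_ ?_) (Prod.ext ?_ ?_)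
  · simp only [Prod.smul_fst]
    match_scalars <;> field_simp <;> (rcases hζ with rfl | rfl <;> ring)
  · simp only [Prod.smul_fst, Prod.smul_snd, smul_eq_mul]
    field_simp
    rcases hζ with rfl | rfl <;> ring
  · simp only [Prod.smul_fst, Prod.smul_snd]
    match_scalars <;> field_simp <;> (rcases hζ with rfl | rfl <;> ring)
  · simp only [Prod.smul_snd, smul_eq_mul]
    field_simp
    rcases hζ with rfl | rfl <;> ring

end Derivative

/-! ### Derivatives of the shift -/

section ShiftDerivative

variable {ζ m k R : ℝ} {γ : ℝ → QPhase} {d : QPhase} {t dw dτ : ℝ}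

/-- The derivatives of ‖W‖ and of the angle are inputs: along S⁻¹ both quantities are simple
functions of ρ and r·p, differentiated directly. -/
theorem hasDerivAt_shift (hζ : ζ = 1 ∨ ζ = -1) (hd : HasDerivAt γ d t)
    (hw : HasDerivAt (fun u => covNorm ζ (γ u)) dw t)
    (hτ : HasDerivAt (fun u => (γ u).2.2 / covNorm ζ (γ u)) dτ t) {w τ : ℝ}
    (hw0 : covNorm ζ (γ t) ≠ 0) (hwt : w = covNorm ζ (γ t))
    (hτt : τ = (γ t).2.2 / covNorm ζ (γ t)) :
    HasDerivAt (fun u => shift ζ R (γ u))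
      ((-(ζ * sn ζ τ * dτ)) • (γ t).1 + cs ζ τ • d.1 +
          (-(ζ * (R * dw / w ^ 2) * sn ζ τ) + ζ * (R / w) * (cs ζ τ * dτ)) • (γ t).2 +
          (ζ * (R / w) * sn ζ τ) • d.2,
        (-(dw / R * sn ζ τ + w / R * (cs ζ τ * dτ))) • (γ t).1 - (w / R * sn ζ τ) • d.1 +
          (-(ζ * sn ζ τ * dτ)) • (γ t).2 + cs ζ τ • d.2) t := by
  subst hwt hτt
  have hcs := (hasDerivAt_cs hζ _).comp t hτ
  have hsn := (hasDerivAt_sn hζ _).comp t hτ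
  have h1 := hasDerivAt_fst_comp hd
  have h2 := hasDerivAt_snd_comp hd
  have hc := (hasDerivAt_const t R).fun_div hw hw0
  have h := ((hcs.fun_smul h1).fun_add (((hc.const_mul ζ).fun_mul hsn).fun_smul h2)).prodMk
    ((((hw.div_const R).fun_mul hsn).fun_neg.fun_smul h1).fun_add (hcs.fun_smul h2))
  refine (h.congr_of_eventuallyEq (Filter.Eventually.of_forall fun u => ?_)).congr_deriv ?_
  · simp only [shift, rot, inv_div, Function.comp_apply]
  · simp only [Function.comp_apply]
    refine Prod.ext ?_ ?_
    · simp only; module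
    · simp only; module

theorem tangent_of_curve (hd : HasDerivAt γ d t) (hζ : ζ = 1 ∨ ζ = -1)
    (hmem : ∀ᶠ u in 𝓝 t, γ u ∈ cotangent ζ R) :
    form ζ (γ t).1 d.1 = 0 ∧ form ζ (γ t).1 d.2 + form ζ d.1 (γ t).2 = 0 := by
  have h1 := hasDerivAt_fst_comp hd
  have h2 := hasDerivAt_snd_comp hd
  constructor
  · have h := (hasDerivAt_form (ζ := ζ) h1 h1).unique
      ((hasDerivAt_const t (ζ * R ^ 2)).congr_of_eventuallyEq
        (hmem.mono fun u hu => form_quadric hζ hu.1))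
    rw [form_comm ζ d.1] at h
    linarith
  · have h := (hasDerivAt_form (ζ := ζ) h1 h2).unique
      ((hasDerivAt_const t (0 : ℝ)).congr_of_eventuallyEq (hmem.mono fun u hu => hu.2))
    linarith

/-- The shift changes the Liouville form by `ζ R ‖W‖ d(W_h / ‖W‖)`. -/
theorem liouville_shift (hζ : ζ = 1 ∨ ζ = -1) (hR : 0 < R) (hd : HasDerivAt γ d t)
    (hw : HasDerivAt (fun u => covNorm ζ (γ u)) dw t)
    (hτ : HasDerivAt (fun u => (γ u).2.2 / covNorm ζ (γ u)) dτ t)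
    (hmem : ∀ᶠ u in 𝓝 t, γ u ∈ cotangent₀ ζ R) {D : QPhase}
    (hD : HasDerivAt (fun u => shift ζ R (γ u)) D t) :
    form ζ (shift ζ R (γ t)).2 D.1 =
      form ζ (γ t).2 d.1 + ζ * R * covNorm ζ (γ t) * dτ := by
  have hy := hmem.self_of_nhds
  have hw0 := covNorm_pos hζ hR hy
  have hww := covNorm_sq hζ hR hy
  have hM := form_quadric hζ hy.1.1
  have hMW := hy.1.2
  obtain ⟨t1, t2⟩ := tangent_of_curve hd hζ (hmem.mono fun u hu => hu.1)
  have h2 := hasDerivAt_snd_comp hd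
  have hdw : form ζ (γ t).2 d.2 = covNorm ζ (γ t) * dw := by
    have h := (hasDerivAt_form (ζ := ζ) h2 h2).unique
      ((hw.fun_pow 2).congr_of_eventuallyEq (hmem.mono fun u hu => covNorm_sq hζ hR hu))
    rw [form_comm ζ d.2] at h
    simp at h
    linarith
  rw [hD.unique (hasDerivAt_shift hζ hd hw hτ hw0.ne' rfl rfl)]
  have t2' : form ζ (γ t).1 d.2 = -form ζ (γ t).2 d.1 := by
    rw [form_comm ζ (γ t).2]; linarith
  have hWM : form ζ (γ t).2 (γ t).1 = 0 := by rw [form_comm]; exact hMW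
  have hcs := cs_sq_add_sn_sq hζ ((γ t).2.2 / covNorm ζ (γ t))
  simp only [shift, rot, inv_div, form_add_left, form_add_right, form_smul_left, form_smul_right,
    hM, hMW, hWM, hww, hdw, t1, t2']
  generalize covNorm ζ (γ t) = w at *
  generalize form ζ (γ t).2 d.1 = θ at *
  generalize (γ t).2.2 / w = τ at *
  field_simp
  rcases hζ with rfl | rfl
  · linear_combination R * w * (θ + R * w * dτ) * hcs
  · linear_combination R * w * (θ - R * w * dτ) * hcs

end ShiftDerivative

/-! ### The Györgyi-Ligon-Schaaf map as a shift of `S⁻¹` -/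

section LigonSchaaf

variable {ζ m k R : ℝ} {x : KPhase}

theorem shift_angle_SInv (hζ : ζ = 1 ∨ ζ = -1) (hm : 0 < m) (hk : 0 < k) (hR : 0 < R)
    (hx : x ∈ keplerPhase ζ m k) :
    (SInv ζ m k R x).2.2 / covNorm ζ (SInv ζ m k R x) =
      ζ / (m ^ 2 * k) * (energyRadius ζ m k x * inner ℝ x.1 x.2) := by
  rw [covNorm_SInv hζ hm hk hR hx, SInv_eq hζ hm hk hR hx]
  simp only
  field_simp

/-- The composition of `S⁻¹` with the flow of `H` at the time `- p · r / (2 E)`. -/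
def flowSInv (ζ m k R : ℝ) (x : KPhase) : QPhase :=
  flow ζ m k R (-(inner ℝ x.2 x.1) / (2 * energy m k x)) (SInv ζ m k R x)

/-- This explains the choice of s: since 2E = -ζρ²/m and ‖W‖ = K/(Rρ), both λs and W_h/‖W‖ equal
ζρ(r·p)/K. -/
theorem flowSInv_eq (hζ : ζ = 1 ∨ ζ = -1) (hm : 0 < m) (hk : 0 < k) (hR : 0 < R)
    (hx : x ∈ keplerPhase ζ m k) :
    flowSInv ζ m k R x = shift ζ R (SInv ζ m k R x) := by
  have hρ := energyRadius_pos hm hx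
  have hz0 := ne_zero_of_sign hζ
  have e : freq ζ m k R (SInv ζ m k R x) * (-(inner ℝ x.2 x.1) / (2 * energy m k x)) =
      (SInv ζ m k R x).2.2 / covNorm ζ (SInv ζ m k R x) := by
    rw [shift_angle_SInv hζ hm hk hR hx, freq, covNorm_SInv hζ hm hk hR hx, energy_eq hζ hm hx,
      real_inner_comm x.1 x.2]
    field_simp
    linear_combination -inner ℝ x.1 x.2 * sq_eq_one_of_sign hζ
  rw [flowSInv, flow, e, shift]

theorem contDiffAt_flowSInv (hζ : ζ = 1 ∨ ζ = -1) (hm : 0 < m) (hk : 0 < k) (hR : 0 < R)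
    (hx : x ∈ keplerPhase ζ m k) : ContDiffAt ℝ ω (flowSInv ζ m k R) x := by
  have h := (contDiffAt_shift hζ hR (SInv_mem hζ hm hk hR hx).1).comp x
    (contDiffAt_SInv hζ hm hk hR hx)
  refine h.congr_of_eventuallyEq ?_
  filter_upwards [isOpen_keplerPhase.mem_nhds hx] with z hz using flowSInv_eq hζ hm hk hR hz

theorem flowSInv_mem (hζ : ζ = 1 ∨ ζ = -1) (hm : 0 < m) (hk : 0 < k) (hR : 0 < R)
    (hx : x ∈ keplerPhase ζ m k) : flowSInv ζ m k R x ∈ cotangentPunctured₀ ζ R := by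
  rw [flowSInv_eq hζ hm hk hR hx]
  exact shift_mem hζ hR (SInv_mem hζ hm hk hR hx)

theorem isDiffeoOnto_flowSInv (hζ : ζ = 1 ∨ ζ = -1) (hm : 0 < m) (hk : 0 < k) (hR : 0 < R) :
    IsDiffeoOnto (flowSInv ζ m k R) (keplerPhase ζ m k) (cotangentPunctured₀ ζ R) := by
  have hS : SmoothOn (SMap ζ m k R) (cotangentPunctured₀ ζ R) := smoothOn_of_contDiffAt
    fun y hy => contDiffAt_SMap hR (form_cov_pos hζ hR hy.1) (sub_height_ne_zero hζ hy)
  refine isDiffeoOnto_of_invOn (g := SMap ζ m k R ∘ unshift ζ R)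
    (smoothOn_of_contDiffAt fun _ hx => contDiffAt_flowSInv hζ hm hk hR hx)
    (hS.comp (smoothOn_unshift hζ hR) fun _ hy => unshift_mem hζ hR hy)
    (fun _ hx => flowSInv_mem hζ hm hk hR hx)
    (fun _ hy => SMap_mem hζ hm hk hR (unshift_mem hζ hR hy)) ⟨fun x hx => ?_, fun y hy => ?_⟩
  · rw [Function.comp_apply, flowSInv_eq hζ hm hk hR hx,
      unshift_shift hζ hR (SInv_mem hζ hm hk hR hx).1, SMap_SInv hζ hm hk hR hx]
  · have hu := unshift_mem hζ hR hy
    rw [Function.comp_apply, flowSInv_eq hζ hm hk hR (SMap_mem hζ hm hk hR hu),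
      SInv_SMap hζ hm hk hR hu, shift_unshift hζ hR hy.1]

/-- The conditions W ≠ 0 and M ≠ N are open. -/
theorem isDiffeoOntoOpen_of_punctured {f : KPhase → QPhase} {A : Set KPhase}
    (h : IsDiffeoOnto f A (cotangentPunctured₀ ζ R)) :
    IsDiffeoOntoOpen f A (cotangent ζ R) := by
  have e : f '' A = cotangentPunctured₀ ζ R := h.1.image_eq
  refine ⟨⟨{y | y.2 ≠ 0} ∩ {y | y.1 ≠ north R},
    (isOpen_ne_fun continuous_snd continuous_const).inter
      (isOpen_ne_fun continuous_fst continuous_const), ?_⟩, by rw [e]; exact h⟩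
  rw [e]
  ext y
  exact ⟨fun hy => ⟨⟨hy.1.2, hy.2⟩, hy.1.1⟩, fun hy => ⟨⟨hy.2, hy.1.1⟩, hy.1.2⟩⟩

theorem fibreFlip_fibreFlip (y : QPhase) : fibreFlip (fibreFlip y) = y := by
  simp [fibreFlip]

theorem fibreFlip_mem {y : QPhase} (hy : y ∈ cotangentPunctured₀ ζ R) :
    fibreFlip y ∈ cotangentPunctured₀ ζ R :=
  ⟨⟨⟨hy.1.1.1, by rw [fibreFlip, form_neg_right, hy.1.1.2, neg_zero]⟩,
    neg_ne_zero.2 hy.1.2⟩, hy.2⟩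

theorem contDiff_fibreFlip : ContDiff ℝ ω fibreFlip := contDiff_fst.prodMk contDiff_snd.neg

theorem isDiffeoOnto_fibreFlip_comp {f : KPhase → QPhase} {A : Set KPhase}
    (h : IsDiffeoOnto f A (cotangentPunctured₀ ζ R)) :
    IsDiffeoOnto (fun x => fibreFlip (f x)) A (cotangentPunctured₀ ζ R) := by
  obtain ⟨hb, hf, g, hg, hinv⟩ := h
  have hflip : ∀ s : Set QPhase, SmoothOn fibreFlip s := fun s =>
    smoothOn_of_contDiffAt fun y _ => contDiff_fibreFlip.contDiffAt
  refine isDiffeoOnto_of_invOn (g := g ∘ fibreFlip) ((hflip _).comp hf hb.mapsTo)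
    (hg.comp (hflip _) fun y hy => fibreFlip_mem hy)
    (fun x hx => fibreFlip_mem (hb.mapsTo hx))
    (fun y hy => hinv.1.mapsTo hb.surjOn (fibreFlip_mem hy))
    ⟨fun x hx => ?_, fun y hy => ?_⟩
  · rw [Function.comp_apply, fibreFlip_fibreFlip, hinv.1 hx]
  · change fibreFlip (f (g (fibreFlip y))) = y
    rw [hinv.2 (fibreFlip_mem hy), fibreFlip_fibreFlip]

theorem gls_eq (hζ : ζ = 1 ∨ ζ = -1) (hm : 0 < m) (hk : 0 < k) (hR : 0 < R)
    (hx : x ∈ keplerPhase ζ m k) :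
    fibreFlip (flowSInv ζ m k R x) = (R • (gls ζ m k x).1, R⁻¹ • (gls ζ m k x).2) := by
  have hρ := energyRadius_pos hm hx
  -- The shift angle is ζφ, with φ the Györgyi-Ligon-Schaaf angle; parity of `cs` and `sn` then
  -- moves ζ outside.
  have e : ζ / (m ^ 2 * k) * (energyRadius ζ m k x * inner ℝ x.1 x.2) =
      ζ * (energyRadius ζ m k x * inner ℝ x.1 x.2 / (m ^ 2 * k)) := by ring
  rw [flowSInv_eq hζ hm hk hR hx, shift, shift_angle_SInv hζ hm hk hR hx, e,
    covNorm_SInv hζ hm hk hR hx, SInv_eq hζ hm hk hR hx]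
  simp only [fibreFlip, rot, gls, cs_sign_mul hζ, sn_sign_mul hζ]
  have hK : 0 < m ^ 2 * k := by positivity
  generalize m ^ 2 * k = K at *
  generalize energyRadius ζ m k x = ρ at *
  generalize inner ℝ x.1 x.2 = a at *
  generalize ‖x.1‖ = n at *
  generalize cs ζ (ρ * a / K) = c at *
  generalize sn ζ (ρ * a / K) = s at *
  refine Prod.ext (Prod.ext ?_ ?_) (Prod.ext ?_ ?_)
  · simp only [Prod.smul_fst, Prod.fst_add]
    match_scalars <;> field_simp <;> (rcases hζ with rfl | rfl <;> ring)
  · simp only [Prod.smul_snd, Prod.snd_add, smul_eq_mul]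
    field_simp
    rcases hζ with rfl | rfl <;> ring
  · simp only [Prod.smul_fst, Prod.fst_add, Prod.fst_neg]
    match_scalars <;> field_simp <;> (rcases hζ with rfl | rfl <;> ring)
  · simp only [Prod.smul_snd, Prod.snd_add, Prod.snd_neg, smul_eq_mul]
    field_simp
    rcases hζ with rfl | rfl <;> ring

end LigonSchaaf

/-! ### Symplecticity and transformation of the vector fields -/

section Symplectic

variable {ζ m k R : ℝ} {x : KPhase}

theorem hasDerivAt_covNorm_SInv (hζ : ζ = 1 ∨ ζ = -1) (hm : 0 < m) (hk : 0 < k) (hR : 0 < R)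
    (hx : x ∈ keplerPhase ζ m k) (v : KPhase) {dρ : ℝ}
    (h : HasDerivAt (fun t : ℝ => energyRadius ζ m k (x + t • v)) dρ 0) :
    HasDerivAt (fun t : ℝ => covNorm ζ (SInv ζ m k R (x + t • v)))
      (-(m ^ 2 * k / R * dρ / energyRadius ζ m k x ^ 2)) 0 := by
  have hρ := energyRadius_pos hm hx
  have e0 : x + (0 : ℝ) • v = x := by simp
  have h1 := (hasDerivAt_const (0 : ℝ) (m ^ 2 * k)).fun_div (h.const_mul R)
    (by rw [e0]; positivity)
  refine (h1.congr_of_eventuallyEq ?_).congr_deriv ?_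
  · filter_upwards [eventually_line_mem hx v] with t ht using covNorm_SInv hζ hm hk hR ht
  · rw [e0]; field_simp; ring

theorem hasDerivAt_shift_angle (hζ : ζ = 1 ∨ ζ = -1) (hm : 0 < m) (hk : 0 < k) (hR : 0 < R)
    (hx : x ∈ keplerPhase ζ m k) (v : KPhase) {dρ : ℝ}
    (h : HasDerivAt (fun t : ℝ => energyRadius ζ m k (x + t • v)) dρ 0) :
    HasDerivAt (fun t : ℝ => (SInv ζ m k R (x + t • v)).2.2 / covNorm ζ (SInv ζ m k R (x + t • v)))
      (ζ / (m ^ 2 * k) * (dρ * inner ℝ x.1 x.2 +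
        energyRadius ζ m k x * (inner ℝ x.1 v.2 + inner ℝ v.1 x.2))) 0 := by
  have e0 : x + (0 : ℝ) • v = x := by simp
  have h1 := (h.fun_mul (hasDerivAt_inner_line x v)).const_mul (ζ / (m ^ 2 * k))
  refine (h1.congr_of_eventuallyEq ?_).congr_deriv (by rw [e0])
  filter_upwards [eventually_line_mem hx v] with t ht using shift_angle_SInv hζ hm hk hR ht

theorem hasDerivAt_shift_SInv (hζ : ζ = 1 ∨ ζ = -1) (hm : 0 < m) (hk : 0 < k) (hR : 0 < R)
    (hx : x ∈ keplerPhase ζ m k) (v : KPhase) :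
    HasDerivAt (fun t : ℝ => shift ζ R (SInv ζ m k R (x + t • v)))
      (fderiv ℝ (flowSInv ζ m k R) x v) 0 := by
  refine (hasDerivAt_comp_line ((contDiffAt_flowSInv hζ hm hk hR hx).differentiableAt
    (by simp)) v).congr_of_eventuallyEq ?_
  filter_upwards [eventually_line_mem hx v] with t ht using (flowSInv_eq hζ hm hk hR ht).symm

/-- Since R‖W‖ = K/ρ and τ = ζρ(r·p)/K, the contribution of the shift is d(r·p) + (r·p)dρ/ρ, which
cancels the term in dρ produced by S⁻¹. -/
theorem liouville_flowSInv (hζ : ζ = 1 ∨ ζ = -1) (hm : 0 < m) (hk : 0 < k) (hR : 0 < R)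
    (hx : x ∈ keplerPhase ζ m k) (v : KPhase) :
    form ζ (flowSInv ζ m k R x).2 (fderiv ℝ (flowSInv ζ m k R) x v).1 =
      2 * inner ℝ x.1 v.2 + inner ℝ x.2 v.1 := by
  have hρ := hasDerivAt_energyRadius_line hm hx v
  have hd := hasDerivAt_comp_line ((contDiffAt_SInv hζ hm hk hR hx).differentiableAt (by simp)) v
  have hmem : ∀ᶠ t : ℝ in 𝓝 0, SInv ζ m k R (x + t • v) ∈ cotangent₀ ζ R := by
    filter_upwards [eventually_line_mem hx v] with t ht using (SInv_mem hζ hm hk hR ht).1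
  have h := liouville_shift hζ hR hd (hasDerivAt_covNorm_SInv hζ hm hk hR hx v hρ)
    (hasDerivAt_shift_angle hζ hm hk hR hx v hρ) hmem (hasDerivAt_shift_SInv hζ hm hk hR hx v)
  rw [zero_smul, add_zero, liouville_SInv hζ hm hk hR hx, covNorm_SInv hζ hm hk hR hx,
    ← flowSInv_eq hζ hm hk hR hx] at h
  rw [h, real_inner_comm v.1 x.2]
  have hρ0 := energyRadius_pos hm hx
  field_simp
  rcases hζ with rfl | rfl <;> ring

/-- The exterior derivative by hand: differentiate the identity of 1-forms along u and
antisymmetrize in u, v. The second derivative of f is symmetric and drops out. -/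
theorem omegaQ_fderiv_of_liouville {f : KPhase → QPhase} (hf : ContDiffAt ℝ ω f x)
    (h : ∀ᶠ z in 𝓝 x, ∀ v : KPhase,
      form ζ (f z).2 (fderiv ℝ f z v).1 = 2 * inner ℝ z.1 v.2 + inner ℝ z.2 v.1)
    (u v : KPhase) : omegaQ ζ (fderiv ℝ f x u) (fderiv ℝ f x v) = -omegaK u v := by
  have hdf : DifferentiableAt ℝ (fderiv ℝ f) x :=
    (hf.fderiv_right (m := ω) (by simp)).differentiableAt (by simp)
  have hf1 : DifferentiableAt ℝ f x := hf.differentiableAt (by simp)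
  have key : ∀ u v : KPhase, form ζ (fderiv ℝ f x u).2 (fderiv ℝ f x v).1 +
      form ζ (f x).2 (fderiv ℝ (fderiv ℝ f) x u v).1 =
        2 * inner ℝ u.1 v.2 + inner ℝ u.2 v.1 := fun u v => by
    have h1 := hasDerivAt_snd_comp (hasDerivAt_comp_line hf1 u)
    have h2 := hasDerivAt_fst_comp
      ((hasDerivAt_comp_line hdf u).clm_apply (hasDerivAt_const (0 : ℝ) v))
    have h3 := hasDerivAt_form (ζ := ζ) h1 h2
    have hl := hasDerivAt_line x u
    have h4 := (((hasDerivAt_fst_comp hl).inner ℝ (hasDerivAt_const (0 : ℝ) v.2)).const_mul 2).fun_add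
      ((hasDerivAt_snd_comp hl).inner ℝ (hasDerivAt_const (0 : ℝ) v.1))
    have hc : Filter.Tendsto (fun t : ℝ => x + t • u) (𝓝 0) (𝓝 x) := by
      simpa using hl.continuousAt.tendsto
    have h5 := h3.unique (h4.congr_of_eventuallyEq ((hc.eventually h).mono fun t ht => ht v))
    simpa using h5
  have hsymm : fderiv ℝ (fderiv ℝ f) x u v = fderiv ℝ (fderiv ℝ f) x v u :=
    (hf.isSymmSndFDerivAt (by simp)) u v
  have h1 := key u v
  have h2 := key v u
  rw [hsymm] at h1
  simp only [omegaQ, omegaK, real_inner_comm u.1 v.2, real_inner_comm u.2 v.1] at *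
  linarith

theorem omegaQ_flowSInv (hζ : ζ = 1 ∨ ζ = -1) (hm : 0 < m) (hk : 0 < k) (hR : 0 < R)
    (hx : x ∈ keplerPhase ζ m k) (u v : KPhase) :
    omegaQ ζ (fderiv ℝ (flowSInv ζ m k R) x u) (fderiv ℝ (flowSInv ζ m k R) x v) =
      -omegaK u v := by
  refine omegaQ_fderiv_of_liouville (contDiffAt_flowSInv hζ hm hk hR hx) ?_ u v
  filter_upwards [isOpen_keplerPhase.mem_nhds hx] with z hz using
    fun v => liouville_flowSInv hζ hm hk hR hz v

theorem fderiv_energy_XE (hm : m ≠ 0) (hx : x.1 ≠ 0) :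
    fderiv ℝ (energy m k) x (XE m k x) = 0 := by
  rw [XE_eq hm hx, fderiv_energy hm hx]
  simp only [inner_smul_right, real_inner_comm x.1 x.2]
  field_simp
  ring

/-- Energy, hence ρ and ‖W‖, is constant along X_E, so the image vector is a rotation velocity and
only its angular speed must be found. -/
theorem fderiv_flowSInv_XE (hζ : ζ = 1 ∨ ζ = -1) (hm : 0 < m) (hk : 0 < k) (hR : 0 < R)
    (hx : x ∈ keplerPhase ζ m k) :
    fderiv ℝ (flowSInv ζ m k R) x (XE m k x) = -XHvec ζ m k R (flowSInv ζ m k R x) := by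
  set y := SInv ζ m k R x with hy
  have hmem := SInv_mem hζ hm hk hR hx
  have hw : 0 < covNorm ζ y := covNorm_pos hζ hR hmem.1
  have e0 : x + (0 : ℝ) • XE m k x = x := by simp
  have hρ := hasDerivAt_energyRadius_line hm hx (XE m k x)
  simp only [fderiv_energy_XE hm.ne' hx.1, mul_zero, zero_div, neg_zero] at hρ
  have hd := hasDerivAt_comp_line ((contDiffAt_SInv hζ hm hk hR hx).differentiableAt (by simp))
    (XE m k x)
  have hwd := hasDerivAt_covNorm_SInv hζ hm hk hR hx _ hρ
  have hτd := hasDerivAt_shift_angle hζ hm hk hR hx _ hρ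
  set dτ : ℝ := ζ / (m ^ 2 * k) * (0 * inner ℝ x.1 x.2 +
    energyRadius ζ m k x * (inner ℝ x.1 (XE m k x).2 + inner ℝ (XE m k x).1 x.2)) with hdτ
  -- Speed gλ along the geodesic plus the rate of change of the shift angle.
  have hang : conformalFactor R y * freq ζ m k R y + dτ = -freq ζ m k R y := by
    rw [hdτ, XE_eq hm.ne' hx.1, hy, freq, covNorm_SInv hζ hm hk hR hx, conformalFactor,
      SInv_eq hζ hm hk hR hx]
    have hρ0 := energyRadius_pos hm hx
    have hrel := norm_mul_energy hζ hm hx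
    have hn : 0 < ‖x.1‖ := norm_pos_iff.2 hx.1
    simp only [inner_smul_right, real_inner_smul_left, real_inner_self_eq_norm_sq]
    generalize energyRadius ζ m k x = ρ at *
    generalize ‖x.1‖ = n at *
    have e1 : ‖x.2‖ ^ 2 = 2 * (m ^ 2 * k) / n - ζ * ρ ^ 2 := by
      field_simp; linear_combination hrel
    rw [e1]
    have e2 : R * (n * (2 * (m ^ 2 * k) / n - ζ * ρ ^ 2) / (m ^ 2 * k) - 1) - R =
        -(ζ * R * ρ ^ 2 * n / (m ^ 2 * k)) := by
      field_simp; ring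
    rw [e2]
    field_simp
    rcases hζ with rfl | rfl <;> ring
  have hang' : dτ = -(freq ζ m k R y * (1 + conformalFactor R y)) := by linarith
  have h := hasDerivAt_shift (R := R) hζ hd hwd hτd
    (by rw [e0]; exact hw.ne') rfl rfl
  rw [(hasDerivAt_shift_SInv hζ hm hk hR hx (XE m k x)).unique h, flowSInv_eq hζ hm hk hR hx]
  rw [fderiv_SInv_XE hζ hm hk hR hx, XH_eq hζ hR hmem.1, e0, ← hy]
  have e : covNorm ζ (shift ζ R y) = covNorm ζ y := covNorm_rot hζ hR hmem.1 _
  have e' : freq ζ m k R (shift ζ R y) = freq ζ m k R y := by rw [freq, e, freq]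
  rw [XHvec, XHvec, e, e', hang']
  simp only [shift, rot, inv_div, mul_zero, zero_div, neg_zero]
  generalize y.2.2 / covNorm ζ y = τ
  refine Prod.ext ?_ ?_
  · simp only [Prod.smul_fst, Prod.smul_snd, Prod.fst_neg]
    match_scalars <;> field_simp <;> ring
  · simp only [Prod.smul_fst, Prod.smul_snd, Prod.snd_neg]
    match_scalars <;> field_simp <;> ring

theorem fderiv_fibreFlip_comp {f : KPhase → QPhase} (hf : DifferentiableAt ℝ f x) (v : KPhase) :
    fderiv ℝ (fun z => fibreFlip (f z)) x v = fibreFlip (fderiv ℝ f x v) := by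
  have h := hasDerivAt_comp_line hf v
  refine fderiv_apply_eq ((contDiff_fibreFlip.differentiable (by simp)).differentiableAt.comp x hf) ?_
  exact (hasDerivAt_fst_comp h).prodMk (hasDerivAt_snd_comp h).fun_neg

theorem omegaQ_fibreFlip (a b : QPhase) :
    omegaQ ζ (fibreFlip a) (fibreFlip b) = -omegaQ ζ a b := by
  simp only [omegaQ, fibreFlip, form_neg_left]; ring

/-- The flip preserves H and reverses the symplectic form, so it reverses the Hamiltonian field. -/
theorem XHvec_fibreFlip (y : QPhase) :
    XHvec ζ m k R (fibreFlip y) = fibreFlip (-XHvec ζ m k R y) := by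
  have e : covNorm ζ (fibreFlip y) = covNorm ζ y := by
    simp only [covNorm, fibreFlip, form_neg_left, form_neg_right, neg_neg]
  have e' : freq ζ m k R (fibreFlip y) = freq ζ m k R y := by rw [freq, e, freq]
  simp only [XHvec, e, e']
  simp [fibreFlip]

end Symplectic

end Kepler

end

theorem mainTheorem2 (ζ m k R : ℝ) (hζ : ζ = 1 ∨ ζ = -1) (hm : 0 < m) (hk : 0 < k) (hR : 0 < R) :
    -- the Hamiltonian vector fields are well defined, and `XE` is the Kepler vector field
    (∀ x ∈ keplerPhase ζ m k,
      (∃! X : KPhase, IsHamVec ⊤ omegaK (fderiv ℝ (energy m k) x) X) ∧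
      XE m k x = ((1 / m) • x.2, -(k * m / ‖x.1‖ ^ 3) • x.1)) ∧
    SmoothOn (HQ ζ m k R) (cotangent₀ ζ R) ∧
    (∀ y ∈ cotangent₀ ζ R,
      ∃! X : QPhase, IsHamVec (tangentAt ζ y) (omegaQ ζ) (fderiv ℝ (HQ ζ m k R) y) X) ∧
    -- `S⁻¹` is a diffeomorphism that sends `XE` to the conformally Hamiltonian field `g XH`
    IsDiffeoOnto (SInv ζ m k R) (keplerPhase ζ m k) (cotangentPunctured₀ ζ R) ∧
    (∀ x ∈ keplerPhase ζ m k, HQ ζ m k R (SInv ζ m k R x) = energy m k x) ∧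
    (∀ x ∈ keplerPhase ζ m k,
      fderiv ℝ (SInv ζ m k R) x (XE m k x) =
        conformalFactor R (SInv ζ m k R x) • XH ζ m k R (SInv ζ m k R x)) ∧
    -- `XH` is complete on the whole cotangent bundle minus its zero section, with flow `Φ`
    ∃ Φ : ℝ → QPhase → QPhase,
      IsCompleteFlow (cotangent₀ ζ R) (XH ζ m k R) Φ ∧
      (∀ y ∈ cotangent₀ ζ R, ∀ s : ℝ,
        let w := Real.sqrt (form ζ y.2 y.2)
        let lam := k ^ 2 * m ^ 3 / (R ^ 3 * w ^ 3)
        Φ s y = (cs ζ (lam * s) • y.1 + (ζ * (R / w) * sn ζ (lam * s)) • y.2,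
          -((w / R) * sn ζ (lam * s)) • y.1 + cs ζ (lam * s) • y.2)) ∧
      -- the composition `F` of `S⁻¹` with the flow at `s = - p · r / (2 E)`, and `G = (M, -W) ∘ F`
      ∃ F G : KPhase → QPhase,
        (∀ x, F x = Φ (-(inner ℝ x.2 x.1) / (2 * energy m k x)) (SInv ζ m k R x)) ∧
        (∀ x, G x = fibreFlip (F x)) ∧
        IsDiffeoOntoOpen F (keplerPhase ζ m k) (cotangent ζ R) ∧
        (∀ x ∈ keplerPhase ζ m k, ∀ u v : KPhase,
          omegaQ ζ (fderiv ℝ F x u) (fderiv ℝ F x v) = -omegaK u v) ∧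
        IsDiffeoOntoOpen G (keplerPhase ζ m k) (cotangent ζ R) ∧
        (∀ x ∈ keplerPhase ζ m k, ∀ u v : KPhase,
          omegaQ ζ (fderiv ℝ G x u) (fderiv ℝ G x v) = omegaK u v) ∧
        (∀ x ∈ keplerPhase ζ m k, fderiv ℝ G x (XE m k x) = XH ζ m k R (G x)) ∧
        -- `G` is the Györgyi-Ligon-Schaaf map, up to the homothety of ratio `R`
        (∀ x ∈ keplerPhase ζ m k, G x = (R • (gls ζ m k x).1, R⁻¹ • (gls ζ m k x).2)) := by
  refine ⟨fun x hx => ⟨⟨_, isHamVec_energy hm.ne' hx.1, fun Y hY =>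
      isHamVec_omegaK_unique hY (isHamVec_energy hm.ne' hx.1)⟩, XE_eq hm.ne' hx.1⟩,
    smoothOn_of_contDiffAt fun y hy => contDiffAt_HQ hR.ne' (form_cov_pos hζ hR hy).ne',
    fun y hy => ⟨_, isHamVec_HQ hζ hR hy, fun Y hY =>
      isHamVec_omegaQ_unique hζ hR hy.1 hY (isHamVec_HQ hζ hR hy)⟩,
    isDiffeoOnto_SInv hζ hm hk hR, fun x hx => HQ_SInv hζ hm hk hR hx,
    fun x hx => fderiv_SInv_XE hζ hm hk hR hx, flow ζ m k R, isCompleteFlow_flow hζ hR,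
    fun y _ s => ?_, flowSInv ζ m k R, fun x => fibreFlip (flowSInv ζ m k R x), fun _ => rfl,
    fun _ => rfl, isDiffeoOntoOpen_of_punctured (isDiffeoOnto_flowSInv hζ hm hk hR),
    fun x hx u v => omegaQ_flowSInv hζ hm hk hR hx u v,
    isDiffeoOntoOpen_of_punctured
      (isDiffeoOnto_fibreFlip_comp (isDiffeoOnto_flowSInv hζ hm hk hR)),
    fun x hx u v => ?_, fun x hx => ?_, fun x hx => gls_eq hζ hm hk hR hx⟩
  · simp only [flow, rot, freq, covNorm, inv_div]
  · have hf := (contDiffAt_flowSInv hζ hm hk hR hx).differentiableAt (by simp)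
    rw [fderiv_fibreFlip_comp hf, fderiv_fibreFlip_comp hf, omegaQ_fibreFlip,
      omegaQ_flowSInv hζ hm hk hR hx, neg_neg]
  · have hf := (contDiffAt_flowSInv hζ hm hk hR hx).differentiableAt (by simp)
    rw [fderiv_fibreFlip_comp hf, fderiv_flowSInv_XE hζ hm hk hR hx,
      XH_eq hζ hR (fibreFlip_mem (flowSInv_mem hζ hm hk hR hx)).1, XHvec_fibreFlip]
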